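/- Let $S^1=\mathbb R/\mathbb Z$, let $\Gamma$ be a group of orientation preserving $C^\infty$ diffeomorphisms of $S^1$, and let $\mathcal A=C^\infty(S^1)\rtimes\Gamma$ be the algebraic crossed product: the $*$-algebra of finite sums $a=\sum_{\phi\in\Gamma}a_\phi U^*_\phi$, $a_\phi\in C^\infty(S^1)$, with $U^*_\phi f=(f\circ\phi)U^*_\phi$, $U^*_\phi U^*_\psi=U^*_{\psi\phi}$ and $(a_\phi U^*_\phi)^*=U_\phi\bar a_\phi$, $U_\phi=U^*_{\phi^{-1}}$. Let $\pi$ be the $*$-representation of $\mathcal A$ on $\mathfrak H=L^2(S^1,dx)$ given by $$(\pi(g\,U^*_\phi)\xi)(x)=g(x)\,\phi'(x)^{1/2}\,\xi(\phi(x)),$$ let $\sigma$ be the automorphism of $\mathcal A$ with $\sigma(g\,U^*_\phi)=\phi'\,g\,U^*_\phi$, and let $D=\frac1i\frac{d}{dx}$ be the operator on $L^2(S^1)$ whose domain is the Sobolev space of all $\xi\in L^2(S^1)$ with weak derivative in $L^2(S^1)$. Then, for every $a\in\mathcal A$, the twisted commutators $$D\,\pi(a)-\pi(\sigma(a))\,D\qquad\text{and}\qquad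 |D|\,\pi(a)-\pi(\sigma(a))\,|D|$$ are bounded: $\pi(a)$ maps $\operatorname{dom}D$ (resp. $\operatorname{dom}|D|$) to itself, and the operator is bounded there for the norm of $\mathfrak H$. Consequently $(\mathcal A,\mathfrak H,D)$ is a Lipschitz-regular $\sigma$-spectral triple: $D$ is self-adjoint with compact resolvent, $\sigma(a^*)=(\sigma^{-1}(a))^*$ for all $a\in\mathcal A$, and the above twisted commutators with $D$ and with $|D|$ are bounded for all $a\in\mathcal A$. It is $1$-summable in the sense that $D^{-1}\in\mathcal L^{1,\infty}$: the inverse of $D$ on $(\ker D)^\perp$, extended by $0$ to $\ker D$, is a compact operator whose characteristic values $\mu_k$ are $O(1/k)$. -/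

import Mathlib

open MeasureTheory AddCircle
open scoped ContDiff ENNReal InnerProductSpace

noncomputable section

namespace TransverseTriple

/-- `F : ℝ → ℝ` is a smooth lift, with everywhere positive derivative, of the self-map `φ` of
`S¹ = ℝ/ℤ`. -/
def IsSmoothLift (φ : UnitAddCircle → UnitAddCircle) (F : ℝ → ℝ) : Prop :=
  ContDiff ℝ ∞ F ∧ (∀ t, 0 < deriv F t) ∧ ∀ t : ℝ, ((F t : ℝ) : UnitAddCircle) = φ (t : UnitAddCircle)

theorem isSmoothLift_id : IsSmoothLift id id :=
  ⟨contDiff_id, fun t => by simp, fun t => rfl⟩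

theorem IsSmoothLift.comp {φ ψ : UnitAddCircle → UnitAddCircle} {F G : ℝ → ℝ}
    (hF : IsSmoothLift φ F) (hG : IsSmoothLift ψ G) : IsSmoothLift (φ ∘ ψ) (F ∘ G) := by
  refine ⟨hF.1.comp hG.1, fun t => ?_, fun t => ?_⟩
  · rw [deriv_comp t (hF.1.differentiable (by simp) _) (hG.1.differentiable (by simp) _)]
    exact mul_pos (hF.2.1 _) (hG.2.1 _)
  · simp [hF.2.2, hG.2.2]

/-- The group of orientation preserving diffeomorphisms of `S¹ = ℝ/ℤ`. -/
def DiffCircle : Subgroup (Equiv.Perm UnitAddCircle) where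
  carrier := {φ | (∃ F, IsSmoothLift φ F) ∧ ∃ G, IsSmoothLift φ.symm G}
  mul_mem' := by
    rintro φ ψ ⟨⟨F, hF⟩, ⟨F', hF'⟩⟩ ⟨⟨G, hG⟩, ⟨G', hG'⟩⟩
    exact ⟨⟨F ∘ G, hF.comp hG⟩, ⟨G' ∘ F', hG'.comp hF'⟩⟩
  one_mem' := ⟨⟨id, isSmoothLift_id⟩, ⟨id, isSmoothLift_id⟩⟩
  inv_mem' := by
    rintro φ ⟨h, h'⟩
    exact ⟨h', h⟩

/-- A smooth lift to `ℝ` of a diffeomorphism of the circle. -/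
def smoothLift (φ : DiffCircle) : ℝ → ℝ := φ.2.1.choose

theorem isSmoothLift_smoothLift (φ : DiffCircle) : IsSmoothLift φ.1 (smoothLift φ) := φ.2.1.choose_spec

/-- The derivative `φ'` of a diffeomorphism of `S¹ = ℝ/ℤ`, as a function on the circle: the
derivative of a lift at a representative. -/
def jac (φ : DiffCircle) (x : UnitAddCircle) : ℝ :=
  deriv (smoothLift φ) ((AddCircle.equivIco 1 0 x : Set.Ico (0 : ℝ) (0 + 1)) : ℝ)

/-- Two continuous real functions agreeing modulo `ℤ` differ by a constant integer. -/
theorem exists_int_of_coe_eq {F G : ℝ → ℝ} (hF : Continuous F) (hG : Continuous G)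
    (h : ∀ t, ((F t : ℝ) : UnitAddCircle) = (G t : UnitAddCircle)) :
    ∃ n : ℤ, ∀ t, F t = G t + n := by
  have h1 : ∀ t, ∃ n : ℤ, (n : ℝ) = F t - G t := by
    intro t
    have := h t
    rw [← sub_eq_zero, ← AddCircle.coe_sub, AddCircle.coe_eq_zero_iff] at this
    obtain ⟨n, hn⟩ := this
    exact ⟨n, by simpa using hn⟩
  choose n hn using h1
  have hc : Continuous n := by
    rw [Int.isClosedEmbedding_coe_real.isEmbedding.continuous_iff]
    have : ((↑) ∘ n : ℝ → ℝ) = fun t => F t - G t := funext hn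
    rw [this]
    exact hF.sub hG
  refine ⟨n 0, fun t => ?_⟩
  have : n t = n 0 := PreconnectedSpace.constant inferInstance hc
  have h2 := hn t
  rw [this] at h2
  linarith

theorem jac_coe_of_isSmoothLift (φ : DiffCircle) {F : ℝ → ℝ} (hF : IsSmoothLift φ.1 F) (t : ℝ) :
    jac φ (t : UnitAddCircle) = deriv F t := by
  have hL := isSmoothLift_smoothLift φ
  set s : ℝ := ((AddCircle.equivIco 1 0 (t : UnitAddCircle) : Set.Ico (0 : ℝ) (0 + 1)) : ℝ) with hs
  have hst : (s : UnitAddCircle) = t := (AddCircle.equivIco 1 0).symm_apply_apply _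
  obtain ⟨n, hn⟩ := exists_int_of_coe_eq (F := smoothLift φ) (G := fun u => F (u + (t - s)))
    hL.1.continuous (hF.1.continuous.comp (by fun_prop)) (fun u => by
      rw [hL.2.2, hF.2.2]
      simp [hst])
  have : jac φ (t : UnitAddCircle) = deriv (smoothLift φ) s := rfl
  rw [this, show smoothLift φ = fun u => F (u + (t - s)) + n from funext hn]
  simp [deriv_comp_add_const]

theorem jac_coe (φ : DiffCircle) (t : ℝ) : jac φ (t : UnitAddCircle) = deriv (smoothLift φ) t :=
  jac_coe_of_isSmoothLift φ (isSmoothLift_smoothLift φ) t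

theorem jac_pos (φ : DiffCircle) (x : UnitAddCircle) : 0 < jac φ x :=
  (isSmoothLift_smoothLift φ).2.1 _

theorem jac_one (x : UnitAddCircle) : jac 1 x = 1 := by
  obtain ⟨t, rfl⟩ := QuotientAddGroup.mk_surjective x
  have := jac_coe_of_isSmoothLift 1 (F := id) isSmoothLift_id t
  simpa using this

/-- The chain rule. -/
theorem jac_mul (φ ψ : DiffCircle) (x : UnitAddCircle) :
    jac (φ * ψ) x = jac φ (ψ.1 x) * jac ψ x := by
  obtain ⟨t, rfl⟩ := QuotientAddGroup.mk_surjective x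
  have hF := isSmoothLift_smoothLift φ
  have hG := isSmoothLift_smoothLift ψ
  have h := jac_coe_of_isSmoothLift (φ * ψ) (F := smoothLift φ ∘ smoothLift ψ) (hF.comp hG) t
  rw [deriv_comp t (hF.1.differentiable (by simp) _) (hG.1.differentiable (by simp) _)] at h
  have h2 := jac_coe ψ t
  have h3 := jac_coe φ (smoothLift ψ t)
  rw [hG.2.2] at h3
  change jac (φ * ψ) (t : UnitAddCircle) = jac φ (ψ.1 (t : UnitAddCircle)) * jac ψ (t : UnitAddCircle)
  rw [h, h2, h3]

theorem contDiff_jac (φ : DiffCircle) : ContDiff ℝ ∞ fun t : ℝ => jac φ (t : UnitAddCircle) := by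
  simp only [jac_coe]
  exact (contDiff_infty_iff_deriv.1 (isSmoothLift_smoothLift φ).1).2

theorem continuous_of_coe {X : Type*} [TopologicalSpace X] {f : UnitAddCircle → X}
    (h : Continuous fun t : ℝ => f (t : UnitAddCircle)) : Continuous f :=
  (QuotientAddGroup.isQuotientMap_mk _).continuous_iff.2 h

theorem continuous_jac (φ : DiffCircle) : Continuous (jac φ) :=
  continuous_of_coe (contDiff_jac φ).continuous

theorem continuous_diff (φ : DiffCircle) : Continuous φ.1 := by
  refine continuous_of_coe ?_
  have h := isSmoothLift_smoothLift φ
  simp only [← h.2.2]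
  exact (AddCircle.continuous_mk' 1).comp h.1.continuous

/-- The change of variables formula on the circle. -/
theorem lintegral_jac_mul (φ : DiffCircle) (h : UnitAddCircle → ℝ≥0∞) :
    ∫⁻ x, ENNReal.ofReal (jac φ x) * h (φ.1 x) ∂haarAddCircle = ∫⁻ x, h x ∂haarAddCircle := by
  have hv : (haarAddCircle : Measure UnitAddCircle) = volume := by
    rw [AddCircle.volume_eq_smul_haarAddCircle]; simp
  rw [hv]
  obtain ⟨hs, hp, hc⟩ := isSmoothLift_smoothLift φ
  set F := smoothLift φ
  have hmono : StrictMono F := strictMono_of_deriv_pos hp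
  obtain ⟨n, hn⟩ := exists_int_of_coe_eq (F := fun t => F (t + 1)) (G := F)
    (hs.continuous.comp (by fun_prop)) hs.continuous (fun t => by
      rw [hc, hc, AddCircle.coe_add_period])
  have hn0 : 0 < n := by
    have := hmono (show (0 : ℝ) < 0 + 1 by norm_num)
    rw [hn] at this
    have : (0 : ℝ) < n := by linarith
    exact_mod_cast this
  have hn1 : n = 1 := by
    by_contra hne
    have h2 : (2 : ℝ) ≤ n := by exact_mod_cast (show (2 : ℤ) ≤ n by omega)
    have h01 := hn 0
    simp only [zero_add] at h01
    obtain ⟨t, ht, hFt⟩ := intermediate_value_Ioo (zero_le_one) (hs.continuous.continuousOn (s := Set.Icc 0 1))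
      (show F 0 + 1 ∈ Set.Ioo (F 0) (F 1) from ⟨by linarith, by linarith⟩)
    have : φ.1 (t : UnitAddCircle) = φ.1 ((0 : ℝ) : UnitAddCircle) := by
      rw [← hc, ← hc, hFt, AddCircle.coe_add_period]
    have := φ.1.injective this
    have h3 := (AddCircle.coe_eq_coe_iff_of_mem_Ico (p := (1 : ℝ)) (a := 0) (x := t) (y := 0)
      ⟨ht.1.le, by simpa using ht.2⟩ ⟨le_rfl, by simp⟩).1 this
    exact ht.1.ne' h3
  have himg : F '' Set.Ioc 0 (0 + 1) = Set.Ioc (F 0) (F 0 + 1) := by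
    have h1 : F (0 + 1) = F 0 + 1 := by rw [hn 0, hn1]; simp
    apply Set.Subset.antisymm
    · rintro _ ⟨t, ht, rfl⟩
      exact ⟨hmono ht.1, h1 ▸ hmono.monotone ht.2⟩
    · rw [← h1]
      exact intermediate_value_Ioc (by norm_num) hs.continuous.continuousOn
  rw [← UnitAddCircle.lintegral_preimage 0, ← UnitAddCircle.lintegral_preimage (F 0) h, ← himg,
    lintegral_image_eq_lintegral_abs_deriv_mul measurableSet_Ioc
      (fun x _ => (hs.differentiable (by simp) x).hasDerivAt.hasDerivWithinAt)
      hmono.injective.injOn]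
  refine lintegral_congr fun t => ?_
  rw [jac_coe, hc, abs_of_pos (hp t)]

theorem quasiMeasurePreserving_diff (φ : DiffCircle) :
    Measure.QuasiMeasurePreserving φ.1 haarAddCircle haarAddCircle := by
  refine ⟨(continuous_diff φ).measurable, ?_⟩
  refine Measure.AbsolutelyContinuous.mk fun s hs h0 => ?_
  rw [Measure.map_apply (continuous_diff φ).measurable hs]
  have h1 := lintegral_jac_mul φ (s.indicator 1)
  rw [lintegral_indicator_one hs, h0, lintegral_eq_zero_iff] at h1
  · rw [measure_eq_zero_iff_ae_notMem]
    filter_upwards [h1] with x hx hxs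
    have : φ.1 x ∈ s := hxs
    simp [this, (jac_pos φ x).not_ge] at hx
  · exact ((continuous_jac φ).measurable.ennreal_ofReal).mul
      ((measurable_one.indicator hs).comp (continuous_diff φ).measurable)


/-- The `*`-algebra `C^∞(S¹)` of smooth complex valued functions on the circle. -/
def smoothSubalgebra : StarSubalgebra ℂ C(UnitAddCircle, ℂ) where
  carrier := {f | ContDiff ℝ ∞ fun t : ℝ => f (t : UnitAddCircle)}
  mul_mem' {f g} hf hg := by
    simp only [Set.mem_ofPred_eq, ContinuousMap.mul_apply] at *
    exact hf.mul hg
  add_mem' {f g} hf hg := by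
    simp only [Set.mem_ofPred_eq, ContinuousMap.add_apply] at *
    exact hf.add hg
  algebraMap_mem' c := by
    rw [Set.mem_ofPred_eq]
    exact (contDiff_const : ContDiff ℝ ∞ fun _ : ℝ => algebraMap ℂ ℂ c)
  star_mem' {f} hf := by
    simp only [Set.mem_ofPred_eq, ContinuousMap.star_apply] at *
    exact (Complex.conjCLE.contDiff (n := ∞)).comp hf

/-- The type `C^∞(S¹)`. -/
def SmoothCircle : Type := smoothSubalgebra

instance : CommRing SmoothCircle := inferInstanceAs (CommRing smoothSubalgebra)
instance : Algebra ℂ SmoothCircle := inferInstanceAs (Algebra ℂ smoothSubalgebra)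
instance : StarRing SmoothCircle := inferInstanceAs (StarRing smoothSubalgebra)
instance : StarModule ℂ SmoothCircle := inferInstanceAs (StarModule ℂ smoothSubalgebra)

theorem SmoothCircle.ext {f g : SmoothCircle} (h : ∀ x, f.1 x = g.1 x) : f = g :=
  Subtype.ext (ContinuousMap.ext h)

theorem SmoothCircle.contDiff (f : SmoothCircle) :
    ContDiff ℝ ∞ fun t : ℝ => f.1 (t : UnitAddCircle) := f.2

/-- The smooth function on the circle with a given smooth pull back to `ℝ`. -/
def SmoothCircle.mk (f : UnitAddCircle → ℂ) (h : ContDiff ℝ ∞ fun t : ℝ => f (t : UnitAddCircle)) :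
    SmoothCircle :=
  ⟨⟨f, continuous_of_coe h.continuous⟩, h⟩

/-- The action of diffeomorphisms on smooth functions, `γ • f = f ∘ γ⁻¹`. -/
instance : MulSemiringAction DiffCircle SmoothCircle where
  smul γ f := SmoothCircle.mk (fun x => f.1 (γ⁻¹.1 x)) (by
    have h := isSmoothLift_smoothLift γ⁻¹
    simpa only [Function.comp_def, h.2.2] using f.contDiff.comp h.1)
  one_smul _ := rfl
  mul_smul _ _ _ := rfl
  smul_zero _ := rfl
  smul_add _ _ _ := rfl
  smul_one _ := rfl
  smul_mul _ _ _ := rfl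

theorem smul_smoothCircle_apply (γ : DiffCircle) (f : SmoothCircle) (x : UnitAddCircle) :
    (γ • f).1 x = f.1 (γ⁻¹.1 x) := rfl

theorem smul_star_smoothCircle (γ : DiffCircle) (f : SmoothCircle) :
    γ • star f = star (γ • f) := rfl

instance : SMulCommClass DiffCircle ℂ SmoothCircle := ⟨fun _ _ _ => rfl⟩

/-- The algebraic crossed product `C^∞(S¹) ⋊ Γ`: finite sums of terms `f U_γ`, multiplied by the
rule `U_γ f = (γ • f) U_γ = (f ∘ γ⁻¹) U_γ`. -/
abbrev CrossedProduct (Γ : Subgroup DiffCircle) : Type := SkewMonoidAlgebra SmoothCircle Γ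

/-- The monomial `g U*_φ`, where `U*_φ = U_{φ⁻¹}`. -/
def monomial {Γ : Subgroup DiffCircle} (g : SmoothCircle) (φ : Γ) : CrossedProduct Γ :=
  SkewMonoidAlgebra.single φ⁻¹ g

/-- The product rule: `f U*_φ · g U*_ψ = f (g ∘ φ) U*_{ψ φ}`. -/
theorem monomial_mul_monomial {Γ : Subgroup DiffCircle} (f g : SmoothCircle) (φ ψ : Γ) :
    monomial f φ * monomial g ψ = monomial (f * (φ⁻¹ • g)) (ψ * φ) := by
  simp [monomial, SkewMonoidAlgebra.single_mul_single]

/-- The involution of the crossed product, `(f U_γ)* = U_γ⁻¹ f̄ = (γ⁻¹ • f̄) U_γ⁻¹`. -/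
def crossedStar (Γ : Subgroup DiffCircle) (a : CrossedProduct Γ) : CrossedProduct Γ :=
  a.sum fun γ f => SkewMonoidAlgebra.single γ⁻¹ (γ⁻¹ • star f)

theorem crossedStar_single {Γ : Subgroup DiffCircle} (γ : Γ) (f : SmoothCircle) :
    crossedStar Γ (SkewMonoidAlgebra.single γ f) =
      SkewMonoidAlgebra.single γ⁻¹ (γ⁻¹ • star f) := by
  rw [crossedStar, SkewMonoidAlgebra.sum_single_index]
  simp

theorem crossedStar_add {Γ : Subgroup DiffCircle} (a b : CrossedProduct Γ) :
    crossedStar Γ (a + b) = crossedStar Γ a + crossedStar Γ b := by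
  rw [crossedStar, SkewMonoidAlgebra.sum_add_index']
  · rfl
  · simp
  · intro γ f g
    rw [star_add, smul_add, SkewMonoidAlgebra.single_add]

instance (Γ : Subgroup DiffCircle) : StarRing (CrossedProduct Γ) where
  star := crossedStar Γ
  star_involutive a := by
    induction a using SkewMonoidAlgebra.induction_on' with
    | single γ f =>
      rw [crossedStar_single, crossedStar_single]
      have : star (γ⁻¹ • star f) = γ⁻¹ • f := by
        change star ((γ⁻¹ : Γ).1 • star f) = (γ⁻¹ : Γ).1 • f
        rw [smul_star_smoothCircle, star_star]
      rw [this, inv_inv, smul_inv_smul]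
    | add a b ha hb => rw [crossedStar_add, crossedStar_add, ha, hb]
  star_mul a b := by
    change crossedStar Γ (a * b) = crossedStar Γ b * crossedStar Γ a
    induction a using SkewMonoidAlgebra.induction_on' with
    | add a a' ha hb => rw [add_mul, crossedStar_add, crossedStar_add, ha, hb, mul_add]
    | single γ f =>
      induction b using SkewMonoidAlgebra.induction_on' with
      | add b b' ha hb => rw [mul_add, crossedStar_add, crossedStar_add, ha, hb, add_mul]
      | single δ g =>
        rw [crossedStar_single, crossedStar_single, SkewMonoidAlgebra.single_mul_single,
          SkewMonoidAlgebra.single_mul_single, crossedStar_single, mul_inv_rev]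
        congr 1
        have : star (γ • g) = γ • star g := (smul_star_smoothCircle γ.1 g).symm
        rw [star_mul, this, smul_mul', mul_smul, inv_smul_smul, mul_smul]
  star_add := crossedStar_add

instance (Γ : Subgroup DiffCircle) : StarModule ℂ (CrossedProduct Γ) where
  star_smul c a := by
    change crossedStar Γ (c • a) = star c • crossedStar Γ a
    induction a using SkewMonoidAlgebra.induction_on' with
    | add a b ha hb => rw [smul_add, crossedStar_add, crossedStar_add, ha, hb, smul_add]
    | single γ f =>
      rw [SkewMonoidAlgebra.smul_single, crossedStar_single, crossedStar_single,
        SkewMonoidAlgebra.smul_single, star_smul, smul_comm]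

theorem star_single {Γ : Subgroup DiffCircle} (γ : Γ) (f : SmoothCircle) :
    star (SkewMonoidAlgebra.single γ f : CrossedProduct Γ) =
      SkewMonoidAlgebra.single γ⁻¹ (γ⁻¹ • star f) := crossedStar_single γ f

/-- The endomorphism `f U_γ ↦ c(γ) f U_γ` of the crossed product given by a `1`-cocycle `c`. -/
def twist {Γ : Subgroup DiffCircle} (c : Γ → SmoothCircle) (h1 : c 1 = 1)
    (hmul : ∀ γ δ, c (γ * δ) = c γ * γ • c δ) : CrossedProduct Γ →ₐ[ℂ] CrossedProduct Γ :=
  SkewMonoidAlgebra.liftNCAlgHom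
    { (SkewMonoidAlgebra.singleOneRingHom : SmoothCircle →+* CrossedProduct Γ) with
      commutes' := fun _ => rfl }
    { toFun := fun γ => SkewMonoidAlgebra.single γ (c γ)
      map_one' := by rw [h1]; rfl
      map_mul' := fun γ δ => by rw [SkewMonoidAlgebra.single_mul_single, hmul] }
    (by
      intro f γ
      change SkewMonoidAlgebra.single 1 (γ • f) * SkewMonoidAlgebra.single γ (c γ) =
        SkewMonoidAlgebra.single γ (c γ) * SkewMonoidAlgebra.single 1 f
      rw [SkewMonoidAlgebra.single_mul_single, SkewMonoidAlgebra.single_mul_single, one_mul,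
        mul_one, one_smul, mul_comm])

theorem twist_single {Γ : Subgroup DiffCircle} (c : Γ → SmoothCircle) (h1 : c 1 = 1)
    (hmul : ∀ γ δ, c (γ * δ) = c γ * γ • c δ) (γ : Γ) (f : SmoothCircle) :
    twist c h1 hmul (SkewMonoidAlgebra.single γ f) = SkewMonoidAlgebra.single γ (c γ * f) := by
  change SkewMonoidAlgebra.liftNC _ _ _ = _
  rw [SkewMonoidAlgebra.liftNC_single]
  change SkewMonoidAlgebra.single 1 f * SkewMonoidAlgebra.single γ (c γ) = _
  rw [SkewMonoidAlgebra.single_mul_single, one_mul, one_smul, mul_comm]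

/-- The Jacobian `φ'` as a smooth function. -/
def jacFun (φ : DiffCircle) : SmoothCircle :=
  SmoothCircle.mk (fun x => (jac φ x : ℂ)) (Complex.ofRealCLM.contDiff.comp (contDiff_jac φ))

/-- The inverse `1 / φ'` of the Jacobian as a smooth function. -/
def jacInvFun (φ : DiffCircle) : SmoothCircle :=
  SmoothCircle.mk (fun x => ((jac φ x)⁻¹ : ℝ)) (Complex.ofRealCLM.contDiff.comp
    ((contDiff_jac φ).inv fun _ => (jac_pos φ _).ne'))

theorem jacFun_apply (φ : DiffCircle) (x : UnitAddCircle) : (jacFun φ).1 x = jac φ x := rfl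

theorem jacInvFun_apply (φ : DiffCircle) (x : UnitAddCircle) :
    (jacInvFun φ).1 x = ((jac φ x)⁻¹ : ℝ) := rfl

/-- The twist `f U*_φ ↦ φ' f U*_φ`. -/
def sigmaHom (Γ : Subgroup DiffCircle) : CrossedProduct Γ →ₐ[ℂ] CrossedProduct Γ :=
  twist (fun γ => jacFun γ.1⁻¹)
    (SmoothCircle.ext fun x => by
      change (jac (1 : DiffCircle)⁻¹ x : ℂ) = 1
      rw [inv_one, jac_one, Complex.ofReal_one])
    (fun γ δ => SmoothCircle.ext fun x => by
      change (jac (γ.1 * δ.1)⁻¹ x : ℂ) = jac γ.1⁻¹ x * jac δ.1⁻¹ (γ.1⁻¹.1 x)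
      rw [mul_inv_rev, jac_mul]
      push_cast
      ring)

/-- The inverse twist `f U*_φ ↦ (φ')⁻¹ f U*_φ`. -/
def sigmaInvHom (Γ : Subgroup DiffCircle) : CrossedProduct Γ →ₐ[ℂ] CrossedProduct Γ :=
  twist (fun γ => jacInvFun γ.1⁻¹)
    (SmoothCircle.ext fun x => by
      change (((jac (1 : DiffCircle)⁻¹ x)⁻¹ : ℝ) : ℂ) = 1
      rw [inv_one, jac_one, inv_one, Complex.ofReal_one])
    (fun γ δ => SmoothCircle.ext fun x => by
      change (((jac (γ.1 * δ.1)⁻¹ x)⁻¹ : ℝ) : ℂ) =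
        ((jac γ.1⁻¹ x)⁻¹ : ℝ) * ((jac δ.1⁻¹ (γ.1⁻¹.1 x))⁻¹ : ℝ)
      rw [mul_inv_rev, jac_mul]
      push_cast
      rw [mul_inv, mul_comm])

/-- The automorphism `σ` of the crossed product, `σ(g U*_φ) = φ' g U*_φ`. -/
def sigma (Γ : Subgroup DiffCircle) : CrossedProduct Γ ≃ₐ[ℂ] CrossedProduct Γ :=
  { sigmaHom Γ with
    invFun := sigmaInvHom Γ
    left_inv := fun a => by
      change sigmaInvHom Γ (sigmaHom Γ a) = a
      induction a using SkewMonoidAlgebra.induction_on' with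
      | add a b ha hb => rw [map_add, map_add, ha, hb]
      | single γ f =>
        rw [sigmaHom, sigmaInvHom, twist_single, twist_single, ← mul_assoc]
        congr 1
        refine SmoothCircle.ext fun x => ?_
        change (((jac γ.1⁻¹ x)⁻¹ : ℝ) : ℂ) * jac γ.1⁻¹ x * f.1 x = f.1 x
        rw [← Complex.ofReal_mul, inv_mul_cancel₀ (jac_pos _ _).ne']
        simp
    right_inv := fun a => by
      change sigmaHom Γ (sigmaInvHom Γ a) = a
      induction a using SkewMonoidAlgebra.induction_on' with
      | add a b ha hb => rw [map_add, map_add, ha, hb]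
      | single γ f =>
        rw [sigmaHom, sigmaInvHom, twist_single, twist_single, ← mul_assoc]
        congr 1
        refine SmoothCircle.ext fun x => ?_
        change (jac γ.1⁻¹ x : ℂ) * ((jac γ.1⁻¹ x)⁻¹ : ℝ) * f.1 x = f.1 x
        rw [← Complex.ofReal_mul, mul_inv_cancel₀ (jac_pos _ _).ne']
        simp }

theorem sigma_monomial {Γ : Subgroup DiffCircle} (g : SmoothCircle) (φ : Γ) :
    sigma Γ (monomial g φ) = monomial (jacFun φ.1 * g) φ := by
  change sigmaHom Γ (SkewMonoidAlgebra.single φ⁻¹ g) = _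
  rw [sigmaHom, twist_single]
  simp [monomial]

theorem star_monomial {Γ : Subgroup DiffCircle} (g : SmoothCircle) (φ : Γ) :
    star (monomial g φ) = monomial (φ • star g) φ⁻¹ := by
  rw [monomial, star_single, inv_inv]
  simp [monomial]

/-- The Hilbert space `L²(S¹)`, for the Lebesgue measure `dx` of `ℝ/ℤ` (of total mass `1`). -/
abbrev L2Circle : Type := Lp ℂ 2 (haarAddCircle : Measure UnitAddCircle)

/-- The square root `(φ')^{1/2}` of the Jacobian. -/
def sqrtJac (φ : DiffCircle) : C(UnitAddCircle, ℂ) :=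
  ⟨fun x => (Real.sqrt (jac φ x) : ℂ),
    Complex.continuous_ofReal.comp (Real.continuous_sqrt.comp (continuous_jac φ))⟩

theorem sqrtJac_ne_zero (φ : DiffCircle) (x : UnitAddCircle) : sqrtJac φ x ≠ 0 :=
  Complex.ofReal_ne_zero.2 (Real.sqrt_pos.2 (jac_pos φ x)).ne'

theorem eLpNorm_sqrtJac_mul (φ : DiffCircle) (ξ : UnitAddCircle → ℂ) :
    eLpNorm (fun x => sqrtJac φ x * ξ (φ.1 x)) 2 haarAddCircle = eLpNorm ξ 2 haarAddCircle := by
  rw [eLpNorm_eq_lintegral_rpow_enorm_toReal (by simp) (by simp),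
    eLpNorm_eq_lintegral_rpow_enorm_toReal (by simp) (by simp)]
  congr 1
  rw [← lintegral_jac_mul φ fun x => ‖ξ x‖ₑ ^ (2 : ℝ≥0∞).toReal]
  refine lintegral_congr fun x => ?_
  have h : ‖sqrtJac φ x‖ₑ ^ (2 : ℝ) = ENNReal.ofReal (jac φ x) := by
    have h0 : ‖sqrtJac φ x‖ = Real.sqrt (jac φ x) :=
      (Complex.norm_real _).trans (abs_of_nonneg (Real.sqrt_nonneg _))
    rw [← ofReal_norm, h0, ENNReal.ofReal_rpow_of_nonneg (Real.sqrt_nonneg _) (by norm_num)]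
    congr 1
    rw [Real.rpow_two, Real.sq_sqrt (jac_pos φ x).le]
  rw [enorm_mul, ENNReal.mul_rpow_of_nonneg _ _ (by simp), ENNReal.toReal_ofNat, h]

/-- A bound for a weight in terms of the square root of the Jacobian. -/
theorem exists_weight_le (w : C(UnitAddCircle, ℂ)) (φ : DiffCircle) :
    ∃ C : ℝ, 0 ≤ C ∧ ∀ (ξ : UnitAddCircle → ℂ) (x : UnitAddCircle),
      ‖w x * ξ (φ.1 x)‖ ≤ C * ‖sqrtJac φ x * ξ (φ.1 x)‖ := by
  let u : C(UnitAddCircle, ℂ) :=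
    ⟨fun x => w x / sqrtJac φ x, w.continuous.div (sqrtJac φ).continuous (sqrtJac_ne_zero φ)⟩
  refine ⟨‖u‖, norm_nonneg _, fun ξ x => ?_⟩
  have h : w x * ξ (φ.1 x) = u x * (sqrtJac φ x * ξ (φ.1 x)) := by
    rw [← mul_assoc]
    congr 1
    exact (div_mul_cancel₀ _ (sqrtJac_ne_zero φ x)).symm
  rw [h, norm_mul]
  exact mul_le_mul_of_nonneg_right (u.norm_coe_le_norm x) (norm_nonneg _)

theorem memLp_weight {w : UnitAddCircle → ℂ} (hw : Continuous w) {φ : DiffCircle}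
    {ξ : UnitAddCircle → ℂ} (hξ : MemLp ξ 2 haarAddCircle) :
    MemLp (fun x => w x * ξ (φ.1 x)) 2 (haarAddCircle : Measure UnitAddCircle) := by
  have hm := hξ.1.comp_quasiMeasurePreserving (quasiMeasurePreserving_diff φ)
  obtain ⟨C, -, hC⟩ := exists_weight_le ⟨w, hw⟩ φ
  refine MemLp.of_le_mul (c := C) (g := fun x => sqrtJac φ x * ξ (φ.1 x))
    ⟨(sqrtJac φ).continuous.aestronglyMeasurable.mul hm, ?_⟩
    (hw.aestronglyMeasurable.mul hm) (Filter.Eventually.of_forall (hC ξ))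
  rw [eLpNorm_sqrtJac_mul]
  exact hξ.2

/-- The weighted composition operator `ξ ↦ w · (ξ ∘ φ)` on `L²(S¹)`, as a linear map. -/
def weightedLin (w : C(UnitAddCircle, ℂ)) (φ : DiffCircle) : L2Circle →ₗ[ℂ] L2Circle where
  toFun ξ := (memLp_weight w.continuous (φ := φ) (Lp.memLp ξ)).toLp _
  map_add' ξ η := by
    refine Lp.ext ?_
    filter_upwards [MemLp.coeFn_toLp (memLp_weight w.continuous (φ := φ) (Lp.memLp (ξ + η))),
      MemLp.coeFn_toLp (memLp_weight w.continuous (φ := φ) (Lp.memLp ξ)),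
      MemLp.coeFn_toLp (memLp_weight w.continuous (φ := φ) (Lp.memLp η)),
      Lp.coeFn_add ((memLp_weight w.continuous (φ := φ) (Lp.memLp ξ)).toLp _)
        ((memLp_weight w.continuous (φ := φ) (Lp.memLp η)).toLp _),
      (quasiMeasurePreserving_diff φ).ae (Lp.coeFn_add ξ η)] with x h1 h2 h3 h4 h5
    rw [h1, h4, Pi.add_apply, h2, h3, h5, Pi.add_apply, mul_add]
  map_smul' c ξ := by
    refine Lp.ext ?_
    filter_upwards [MemLp.coeFn_toLp (memLp_weight w.continuous (φ := φ) (Lp.memLp (c • ξ))),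
      MemLp.coeFn_toLp (memLp_weight w.continuous (φ := φ) (Lp.memLp ξ)),
      Lp.coeFn_smul c ((memLp_weight w.continuous (φ := φ) (Lp.memLp ξ)).toLp _),
      (quasiMeasurePreserving_diff φ).ae (Lp.coeFn_smul c ξ)] with x h1 h2 h3 h4
    rw [h1, RingHom.id_apply, h3, Pi.smul_apply, h2, h4, Pi.smul_apply, smul_eq_mul, smul_eq_mul]
    ring

theorem weightedLin_ae (w : C(UnitAddCircle, ℂ)) (φ : DiffCircle) (ξ : L2Circle) :
    weightedLin w φ ξ =ᵐ[haarAddCircle] fun x => w x * ξ (φ.1 x) :=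
  MemLp.coeFn_toLp (memLp_weight w.continuous (φ := φ) (Lp.memLp ξ))

theorem exists_weight_bound (w : C(UnitAddCircle, ℂ)) (φ : DiffCircle) :
    ∃ C, ∀ ξ : L2Circle, ‖weightedLin w φ ξ‖ ≤ C * ‖ξ‖ := by
  obtain ⟨C, hC0, hC⟩ := exists_weight_le w φ
  refine ⟨C, fun ξ => ?_⟩
  rw [Lp.norm_def, Lp.norm_def, eLpNorm_congr_ae (weightedLin_ae w φ ξ),
    ← eLpNorm_sqrtJac_mul φ ξ, ← ENNReal.toReal_ofReal hC0, ← ENNReal.toReal_mul]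
  refine ENNReal.toReal_mono (ENNReal.mul_ne_top ENNReal.ofReal_ne_top ?_)
    (eLpNorm_le_mul_eLpNorm_of_ae_le_mul (Filter.Eventually.of_forall (hC ξ)) 2)
  rw [eLpNorm_sqrtJac_mul]
  exact Lp.eLpNorm_ne_top ξ

/-- The bounded operator `ξ ↦ w · (ξ ∘ φ)` on `L²(S¹)`. -/
def weighted (w : C(UnitAddCircle, ℂ)) (φ : DiffCircle) : L2Circle →L[ℂ] L2Circle :=
  (weightedLin w φ).mkContinuousOfExistsBound (exists_weight_bound w φ)

theorem weighted_ae (w : C(UnitAddCircle, ℂ)) (φ : DiffCircle) (ξ : L2Circle) :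
    weighted w φ ξ =ᵐ[haarAddCircle] fun x => w x * ξ (φ.1 x) := weightedLin_ae w φ ξ

theorem weighted_eq {w : C(UnitAddCircle, ℂ)} {φ : DiffCircle} {ξ η : L2Circle}
    (h : ∀ᵐ x ∂haarAddCircle, η x = w x * ξ (φ.1 x)) : weighted w φ ξ = η :=
  Lp.ext ((weighted_ae w φ ξ).trans (h.mono fun _ hx => hx.symm))

theorem weighted_mul (w v : C(UnitAddCircle, ℂ)) (φ ψ : DiffCircle) :
    weighted w φ * weighted v ψ =
      weighted (w * v.comp ⟨φ.1, continuous_diff φ⟩) (ψ * φ) := by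
  ext1 ξ
  refine (weighted_eq ?_).symm
  filter_upwards [weighted_ae w φ (weighted v ψ ξ),
    (quasiMeasurePreserving_diff φ).ae (weighted_ae v ψ ξ)] with x h1 h2
  rw [mul_apply_eq_comp, h1, h2, ← mul_assoc]
  rfl

theorem weighted_one : weighted 1 1 = 1 := by
  ext1 ξ
  refine weighted_eq (Filter.Eventually.of_forall fun x => ?_)
  simp

/-- `φ ↦ π(U_φ)`, where `π(U_φ) = π(U*_{φ⁻¹})` is `ξ ↦ ((φ⁻¹)')^{1/2} (ξ ∘ φ⁻¹)`. -/
def piU : DiffCircle →* (L2Circle →L[ℂ] L2Circle) where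
  toFun φ := weighted (sqrtJac φ⁻¹) φ⁻¹
  map_one' := by
    rw [inv_one, ← weighted_one]
    congr 1
    ext x
    simp [sqrtJac, jac_one]
  map_mul' φ ψ := by
    rw [weighted_mul, mul_inv_rev]
    congr 1
    ext x
    change (Real.sqrt (jac (ψ⁻¹ * φ⁻¹) x) : ℂ) =
      Real.sqrt (jac φ⁻¹ x) * Real.sqrt (jac ψ⁻¹ (φ⁻¹.1 x))
    rw [jac_mul, Real.sqrt_mul (jac_pos _ _).le]
    push_cast
    ring

/-- Multiplication operators by smooth functions. -/
def piM : SmoothCircle →ₐ[ℂ] (L2Circle →L[ℂ] L2Circle) where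
  toFun f := weighted f.1 1
  map_one' := weighted_one
  map_zero' := by
    ext1 ξ
    refine weighted_eq ?_
    filter_upwards [Lp.coeFn_zero ℂ 2 (haarAddCircle : Measure UnitAddCircle)] with x h1
    change (0 : L2Circle) x = 0 * _
    rw [h1, zero_mul, Pi.zero_apply]
  map_mul' f g := by
    rw [weighted_mul]
    rfl
  map_add' f g := by
    ext1 ξ
    refine weighted_eq ?_
    filter_upwards [weighted_ae f.1 1 ξ, weighted_ae g.1 1 ξ,
      Lp.coeFn_add (weighted f.1 1 ξ) (weighted g.1 1 ξ)] with x h1 h2 h3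
    rw [add_apply, h3, Pi.add_apply, h1, h2, ← add_mul]
    rfl
  commutes' c := by
    ext1 ξ
    refine weighted_eq ?_
    rw [Algebra.algebraMap_eq_smul_one]
    filter_upwards [Lp.coeFn_smul c ξ] with x h1
    change (c • ξ : L2Circle) x = _
    rw [h1]
    rfl

theorem piM_smul_mul_piU (φ : DiffCircle) (f : SmoothCircle) :
    piM (φ • f) * piU φ = piU φ * piM f := by
  change weighted _ _ * weighted _ _ = weighted _ _ * weighted _ _
  rw [weighted_mul, weighted_mul, one_mul, mul_one]
  congr 1
  ext x
  exact mul_comm _ _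

/-- The representation of the crossed product, as a homomorphism of algebras. -/
def piAlgHom (Γ : Subgroup DiffCircle) : CrossedProduct Γ →ₐ[ℂ] (L2Circle →L[ℂ] L2Circle) :=
  SkewMonoidAlgebra.liftNCAlgHom piM (piU.comp Γ.subtype)
    (fun {f γ} => piM_smul_mul_piU γ.1 f)

theorem piAlgHom_eq {Γ : Subgroup DiffCircle} (γ : Γ) (f : SmoothCircle) :
    piAlgHom Γ (SkewMonoidAlgebra.single γ f) = piM f * piU γ.1 := by
  change SkewMonoidAlgebra.liftNC _ _ _ = _
  rw [SkewMonoidAlgebra.liftNC_single]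
  rfl

theorem piAlgHom_single {Γ : Subgroup DiffCircle} (γ : Γ) (f : SmoothCircle) :
    piAlgHom Γ (SkewMonoidAlgebra.single γ f) = weighted (f.1 * sqrtJac γ.1⁻¹) γ.1⁻¹ := by
  rw [piAlgHom_eq]
  change weighted _ _ * weighted _ _ = _
  rw [weighted_mul, mul_one]
  rfl

theorem star_piU (φ : DiffCircle) : star (piU φ) = piU φ⁻¹ := by
  have h1 : ∀ ξ, ‖piU φ ξ‖ = ‖ξ‖ := fun ξ => by
    change ‖weighted (sqrtJac φ⁻¹) φ⁻¹ ξ‖ = ‖ξ‖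
    rw [Lp.norm_def, Lp.norm_def, eLpNorm_congr_ae (weighted_ae (sqrtJac φ⁻¹) φ⁻¹ ξ),
      eLpNorm_sqrtJac_mul]
  have h2 : star (piU φ) * piU φ = 1 :=
    (ContinuousLinearMap.norm_map_iff_adjoint_comp_self _).1 h1
  calc star (piU φ) = star (piU φ) * (piU φ * piU φ⁻¹) := by
        rw [← map_mul, mul_inv_cancel, map_one, mul_one]
    _ = piU φ⁻¹ := by rw [← mul_assoc, h2, one_mul]

theorem star_piM (f : SmoothCircle) : star (piM f) = piM (star f) := by
  refine ((ContinuousLinearMap.eq_adjoint_iff _ _).2 fun ξ η => ?_).symm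
  rw [L2.inner_def, L2.inner_def]
  refine integral_congr_ae ?_
  filter_upwards [weighted_ae (star f).1 1 ξ, weighted_ae f.1 1 η] with x h1 h2
  change inner ℂ (weighted (star f).1 1 ξ x) (η x) = inner ℂ (ξ x) (weighted f.1 1 η x)
  rw [h1, h2]
  change η x * (starRingEnd ℂ) ((starRingEnd ℂ) (f.1 x) * ξ x) =
    f.1 x * η x * (starRingEnd ℂ) (ξ x)
  rw [map_mul, Complex.conj_conj]
  ring

/-- The `*`-representation `(π(g U*_φ) ξ)(x) = g(x) φ'(x)^{1/2} ξ(φ(x))` of the crossed product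
on `L²(S¹)`. -/
def rep (Γ : Subgroup DiffCircle) : CrossedProduct Γ →⋆ₐ[ℂ] (L2Circle →L[ℂ] L2Circle) :=
  { piAlgHom Γ with
    map_star' := fun a => by
      change piAlgHom Γ (star a) = star (piAlgHom Γ a)
      induction a using SkewMonoidAlgebra.induction_on' with
      | add a b ha hb => rw [star_add, map_add, map_add, star_add, ha, hb]
      | single γ f =>
        rw [star_single, piAlgHom_eq, piAlgHom_eq, star_mul, star_piM, star_piU]
        change piM (γ.1⁻¹ • star f) * piU γ.1⁻¹ = piU γ.1⁻¹ * piM (star f)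
        exact piM_smul_mul_piU γ.1⁻¹ (star f) }

theorem rep_monomial {Γ : Subgroup DiffCircle} (g : SmoothCircle) (φ : Γ) (ξ : L2Circle) :
    rep Γ (monomial g φ) ξ =ᵐ[haarAddCircle]
      fun x => g.1 x * ((jac φ.1 x ^ (1 / 2 : ℝ) : ℝ) : ℂ) * ξ (φ.1.1 x) := by
  have h := piAlgHom_single φ⁻¹ g
  rw [InvMemClass.coe_inv, inv_inv] at h
  have h2 : rep Γ (monomial g φ) = weighted (g.1 * sqrtJac φ.1) φ.1 := h
  rw [h2]
  filter_upwards [weighted_ae (g.1 * sqrtJac φ.1) φ.1 ξ] with x hx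
  rw [hx, ← Real.sqrt_eq_rpow]
  rfl

theorem integrable_mul (ξ : L2Circle) (g : SmoothCircle) :
    Integrable (fun x => ξ x * g.1 x) (haarAddCircle : Measure UnitAddCircle) := by
  have h1 : MemLp g.1 2 (haarAddCircle : Measure UnitAddCircle) :=
    MemLp.of_bound g.1.continuous.aestronglyMeasurable ‖g.1‖
      (Filter.Eventually.of_forall g.1.norm_coe_le_norm)
  exact (Lp.memLp ξ).integrable_mul h1

/-- The derivative `df/dx` of a smooth function on `S¹ = ℝ/ℤ`. -/
def SmoothCircle.deriv (f : SmoothCircle) : SmoothCircle :=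
  SmoothCircle.mk (fun x => _root_.deriv (fun t : ℝ => f.1 (x + (t : UnitAddCircle))) 0) (by
    have h : ∀ s : ℝ, _root_.deriv (fun t : ℝ => f.1 ((s : UnitAddCircle) + (t : UnitAddCircle))) 0 =
        _root_.deriv (fun t : ℝ => f.1 (t : UnitAddCircle)) s := fun s => by
      have := deriv_comp_const_add (fun t : ℝ => f.1 (t : UnitAddCircle)) s 0
      simpa using this
    simp only [h]
    exact (contDiff_infty_iff_deriv.1 (SmoothCircle.contDiff f)).2)

/-- The graph of `-i d/dx` in the weak sense: `η = -i ξ'` when `∫ η f = i ∫ ξ f'` for all test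
functions `f ∈ C^∞(S¹)`. -/
def diracGraph : Submodule ℂ (L2Circle × L2Circle) where
  carrier := {p | ∀ f : SmoothCircle,
    ∫ x, p.2 x * f.1 x ∂haarAddCircle = Complex.I * ∫ x, p.1 x * f.deriv.1 x ∂haarAddCircle}
  add_mem' {p q} hp hq f := by
    have h : ∀ (ξ η : L2Circle) (g : SmoothCircle),
        ∫ x, (ξ + η : L2Circle) x * g.1 x ∂haarAddCircle =
          ∫ x, ξ x * g.1 x ∂haarAddCircle + ∫ x, η x * g.1 x ∂haarAddCircle := fun ξ η g => by
      rw [← integral_add (integrable_mul ξ g) (integrable_mul η g)]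
      refine integral_congr_ae ?_
      filter_upwards [Lp.coeFn_add ξ η] with x hx
      rw [hx, Pi.add_apply, add_mul]
    rw [Prod.snd_add, Prod.fst_add, h, h, hp f, hq f, mul_add]
  zero_mem' f := by
    have h : ∀ g : SmoothCircle, ∫ x, (0 : L2Circle) x * g.1 x ∂haarAddCircle = 0 := fun g => by
      refine integral_eq_zero_of_ae ?_
      filter_upwards [Lp.coeFn_zero ℂ 2 (haarAddCircle : Measure UnitAddCircle)] with x hx
      rw [hx, Pi.zero_apply, zero_mul]
    rw [Prod.snd_zero, Prod.fst_zero, h, h, mul_zero]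
  smul_mem' c p hp f := by
    have h : ∀ (ξ : L2Circle) (g : SmoothCircle),
        ∫ x, (c • ξ : L2Circle) x * g.1 x ∂haarAddCircle =
          c * ∫ x, ξ x * g.1 x ∂haarAddCircle := fun ξ g => by
      rw [← integral_const_mul]
      refine integral_congr_ae ?_
      filter_upwards [Lp.coeFn_smul c ξ] with x hx
      rw [hx, Pi.smul_apply, smul_eq_mul, mul_assoc]
    rw [Prod.smul_snd, Prod.smul_fst, h, h, hp f]
    ring

theorem diracGraph_single_valued (p : L2Circle × L2Circle) (hp : p ∈ diracGraph) (h0 : p.1 = 0) :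
    p.2 = 0 := by
  have h : ∀ f : SmoothCircle, ∫ x, p.2 x * f.1 x ∂haarAddCircle = 0 := fun f => by
    rw [hp f, h0]
    have : ∫ x, (0 : L2Circle) x * f.deriv.1 x ∂haarAddCircle = 0 := by
      refine integral_eq_zero_of_ae ?_
      filter_upwards [Lp.coeFn_zero ℂ 2 (haarAddCircle : Measure UnitAddCircle)] with x hx
      rw [hx, Pi.zero_apply, zero_mul]
    rw [this, mul_zero]
  apply fourierBasis.repr.injective
  rw [map_zero]
  refine lp.ext (funext fun n => ?_)
  rw [fourierBasis_repr]
  have h2 := h (SmoothCircle.mk (fourier (-n)) (by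
    simp only [fourier_coe_apply]
    have : ContDiff ℝ ∞ fun t : ℝ => (t : ℂ) := Complex.ofRealCLM.contDiff
    fun_prop))
  change fourierCoeff p.2 n = 0
  rw [fourierCoeff, ← h2]
  refine integral_congr_ae (Filter.Eventually.of_forall fun x => ?_)
  exact mul_comm _ _

/-- The operator `D = -i d/dx` on `L²(S¹)`, with domain the Sobolev space of all `ξ ∈ L²` with weak
derivative in `L²`. -/
def dirac : L2Circle →ₗ.[ℂ] L2Circle := diracGraph.toLinearPMap

theorem graph_dirac : dirac.graph = diracGraph :=
  Submodule.toLinearPMap_graph_eq _ diracGraph_single_valued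

section Triples

variable {H : Type*} [NormedAddCommGroup H] [InnerProductSpace ℂ H] [CompleteSpace H]

/-- `D S - T D` is bounded: `S` maps the domain of `D` to itself, and `D S - T D` is bounded there
for the norm of `H`. -/
def HasBoundedTwistedCommutator (D : H →ₗ.[ℂ] H) (S T : H →L[ℂ] H) : Prop :=
  ∃ C : ℝ, ∀ ξ : D.domain, ∃ h : S ξ ∈ D.domain, ‖D ⟨S ξ, h⟩ - T (D ξ)‖ ≤ C * ‖(ξ : H)‖

/-- The resolvent `R = (D - z)⁻¹` exists and is compact, for some `z ∈ ℂ`. -/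
def HasCompactResolvent (D : H →ₗ.[ℂ] H) : Prop :=
  ∃ (z : ℂ) (R : H →L[ℂ] H), IsCompactOperator R ∧
    (∀ η, ∃ h : R η ∈ D.domain, D ⟨R η, h⟩ - z • R η = η) ∧
    ∀ ξ : D.domain, R (D ξ - z • (ξ : H)) = ξ

/-- `T = |D|` for a self-adjoint operator `D`: `T` is the (unique) positive self-adjoint operator
with `T² = D²` (equality of unbounded operators, including domains). -/
structure IsModulus (D T : H →ₗ.[ℂ] H) : Prop where
  isSelfAdjoint : IsSelfAdjoint T
  nonneg : ∀ ξ : T.domain, 0 ≤ (inner ℂ (ξ : H) (T ξ)).re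
  sq_eq : ∀ ξ ζ : H, (∃ η, (ξ, η) ∈ T.graph ∧ (η, ζ) ∈ T.graph) ↔
    ∃ η, (ξ, η) ∈ D.graph ∧ (η, ζ) ∈ D.graph

/-- `R = D⁻¹` on the orthogonal complement of `ker D`, and `R = 0` on `ker D`. -/
structure IsReducedInverse (D : H →ₗ.[ℂ] H) (R : H →L[ℂ] H) : Prop where
  apply_ker : ∀ ζ : D.domain, D ζ = 0 → R ζ = 0
  map_mem : ∀ η, R η ∈ D.domain
  orthogonal : ∀ η, ∀ ζ : D.domain, D ζ = 0 → inner ℂ (ζ : H) (R η) = 0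
  right_inv : ∀ η, (∀ ζ : D.domain, D ζ = 0 → inner ℂ (ζ : H) η = 0) → D ⟨R η, map_mem η⟩ = η

/-- The characteristic value `μ_k(T)`, `k = 0, 1, 2, …`: the distance of `T` to the operators of
rank at most `k`. -/
def characteristicValue (T : H →L[ℂ] H) (k : ℕ) : ℝ :=
  sInf {r | ∃ S : H →L[ℂ] H, LinearMap.rank (S : H →ₗ[ℂ] H) ≤ k ∧ r = ‖T - S‖}

/-- `D` is `p`-summable: `D⁻¹ ∈ 𝓛^{p,∞}`, i.e. `D⁻¹` is compact with `μ_k(D⁻¹) = O(k^{-1/p})`, where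
`D⁻¹` is taken on the orthogonal complement of `ker D`. -/
def IsFinitelySummable (p : ℝ) (D : H →ₗ.[ℂ] H) : Prop :=
  ∃ R : H →L[ℂ] H, IsReducedInverse D R ∧ IsCompactOperator R ∧
    ∃ C : ℝ, ∀ k : ℕ, characteristicValue R k ≤ C * ((k : ℝ) + 1) ^ (-(1 / p))

variable {A : Type*} [Semiring A] [Algebra ℂ A] [StarRing A]

/-- An (ungraded, involutive) `σ`-spectral triple. -/
structure IsSigmaSpectralTriple (σ : A ≃ₐ[ℂ] A) (π : A →⋆ₐ[ℂ] (H →L[ℂ] H)) (D : H →ₗ.[ℂ] H) :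
    Prop where
  isSelfAdjoint : IsSelfAdjoint D
  compactResolvent : HasCompactResolvent D
  bounded : ∀ a, HasBoundedTwistedCommutator D (π a) (π (σ a))
  unitarity : ∀ a, σ (star a) = star (σ.symm a)

/-- A Lipschitz-regular `σ`-spectral triple. -/
structure IsLipschitzRegularTriple (σ : A ≃ₐ[ℂ] A) (π : A →⋆ₐ[ℂ] (H →L[ℂ] H))
    (D : H →ₗ.[ℂ] H) : Prop extends IsSigmaSpectralTriple σ π D where
  abs_bounded : ∃ T : H →ₗ.[ℂ] H, IsModulus D T ∧
    ∀ a, HasBoundedTwistedCommutator T (π a) (π (σ a))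

end Triples

end TransverseTriple

end

open TransverseTriple

/-! The characters `e_n(x) = e^{2πinx}` diagonalize `D` with eigenvalues `2πn`. Testing the weak
derivative against characters puts `D` inside the diagonal operator, and symmetry of the latter
against smooth functions gives equality of graphs, domains included (`dirac_eq_diagOp`).
Self-adjointness, compact resolvent, the modulus `|D|` (eigenvalues `|2πn|`) and `μ_k = O(1/k)` are
then statements about sequences of eigenvalues.

A monomial acts by `ξ ↦ w · (ξ ∘ φ)`, and `σ` multiplies the weight `w` by `φ'`. By the Leibniz and
chain rules, `D(w · (ξ ∘ φ)) = -i w' · (ξ ∘ φ) + φ' w · ((Dξ) ∘ φ)`. The last term is exactly the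
one subtracted in the twisted commutator, so what remains is a bounded weighted composition operator
(`weighted_mem_diracGraph`).

For `|D|`, let `F = sign D`, `S = π(a)`, `T = π(σ(a))`. Since `|D| = F D`, `|D| S - T |D| = F (D S -
T D) + (F T - T F) D`, so it suffices to bound `(F T - T F) D`
(`HasBoundedTwistedCommutator.abs_diagOp`). Its matrix entries vanish between frequencies `m`, `n`
of equal sign. For different signs the entry of `T` is `∫ w e^{2πi(nφ(x) - mx)} dx`. As `φ' > 0`,
the two terms of the phase derivative `nφ' - m` cannot cancel, so its modulus is at least `c(|m| +
|n|)`. Three integrations by parts give decay `(|m| + |n|)^{-3}` (`exists_norm_repr_weighted_le`),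
which makes `(F T - T F) D` Hilbert-Schmidt (`summable_diracSign_commutator`). -/

namespace TransverseTriple

/-! ### Bounded and unbounded diagonal operators in a Hilbert basis. -/

section Diagonal

variable {ι H : Type*} [NormedAddCommGroup H] [InnerProductSpace ℂ H]

theorem ext_repr (b : HilbertBasis ι ℂ H) {ξ η : H} (h : ∀ i, b.repr ξ i = b.repr η i) : ξ = η :=
  b.repr.injective (lp.ext (funext h))

theorem norm_le_mul_norm_of_repr (b : HilbertBasis ι ℂ H) {ξ η : H} {C : ℝ} (hC : 0 ≤ C)
    (h : ∀ i, ‖b.repr η i‖ ≤ C * ‖b.repr ξ i‖) : ‖η‖ ≤ C * ‖ξ‖ := by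
  have h1 : ‖b.repr η‖ ≤ ‖(C : ℂ) • b.repr ξ‖ := lp.norm_mono (by simp) fun i => by
    rw [lp.coeFn_smul, Pi.smul_apply, norm_smul, Complex.norm_real, Real.norm_of_nonneg hC]
    exact h i
  rwa [norm_smul, Complex.norm_real, Real.norm_of_nonneg hC, b.repr.norm_map, b.repr.norm_map]
    at h1

/-- The bounded operator with diagonal matrix `c` in the Hilbert basis `b`. -/
noncomputable def diagCLM (b : HilbertBasis ι ℂ H) {c : ι → ℂ} {C : ℝ} (hC : 0 ≤ C)
    (hc : ∀ i, ‖c i‖ ≤ C) : H →L[ℂ] H :=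
  LinearMap.mkContinuous
    { toFun := fun ξ => b.repr.symm ⟨fun i => c i * b.repr ξ i,
        Memℓp.mono' (g := ((C : ℂ) • b.repr ξ : lp (fun _ : ι => ℂ) 2)) (lp.memℓp _) fun i => by
          rw [lp.coeFn_smul, Pi.smul_apply, norm_smul, norm_mul, Complex.norm_real,
            Real.norm_of_nonneg hC]
          exact mul_le_mul_of_nonneg_right (hc i) (norm_nonneg _)⟩
      map_add' := fun ξ η => ext_repr b fun i => by
        simp [mul_add]
        rfl
      map_smul' := fun a ξ => ext_repr b fun i => by
        simp [mul_left_comm] }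
    C fun ξ => norm_le_mul_norm_of_repr b hC fun i => by
      simp only [LinearMap.coe_mk, AddHom.coe_mk, LinearIsometryEquiv.apply_symm_apply, norm_mul]
      exact mul_le_mul_of_nonneg_right (hc i) (norm_nonneg _)

theorem repr_diagCLM (b : HilbertBasis ι ℂ H) {c : ι → ℂ} {C : ℝ} (hC : 0 ≤ C)
    (hc : ∀ i, ‖c i‖ ≤ C) (ξ : H) (i : ι) :
    b.repr (diagCLM b hC hc ξ) i = c i * b.repr ξ i := by
  change b.repr (b.repr.symm _) i = _
  rw [b.repr.apply_symm_apply]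

/-- The part of a diagonal operator supported on a finite set of indices. -/
theorem exists_finite_truncation (b : HilbertBasis ι ℂ H) {c : ι → ℂ} {C : ℝ} (hC : 0 ≤ C)
    (hc : ∀ i, ‖c i‖ ≤ C) (s : Finset ι) {ε : ℝ} (hε : 0 ≤ ε) (h : ∀ i ∉ s, ‖c i‖ ≤ ε) :
    ∃ S : H →L[ℂ] H, LinearMap.rank (S : H →ₗ[ℂ] H) ≤ s.card ∧ IsCompactOperator S ∧
      ‖diagCLM b hC hc - S‖ ≤ ε := by
  classical
  have hc' : ∀ i, ‖if i ∈ s then c i else 0‖ ≤ C := fun i => by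
    split_ifs
    · exact hc i
    · simpa using hC
  set S := diagCLM b hC hc'
  set U : Submodule ℂ H := Submodule.span ℂ ((s.image b : Finset H) : Set H)
  have hU : ∀ ξ, S ξ ∈ U := fun ξ => by
    have h1 : S ξ = ∑ i ∈ s, (c i * b.repr ξ i) • b i := by
      refine (b.hasSum_repr (S ξ)).unique ?_
      have h2 : ∑ i ∈ s, (c i * b.repr ξ i) • b i = ∑ i ∈ s, b.repr (S ξ) i • b i :=
        Finset.sum_congr rfl fun i hi => by rw [repr_diagCLM, if_pos hi]
      rw [h2]
      refine hasSum_sum_of_ne_finset_zero fun i hi => ?_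
      rw [repr_diagCLM, if_neg hi, zero_mul, zero_smul]
    rw [h1]
    exact Submodule.sum_mem _ fun i hi =>
      U.smul_mem _ (Submodule.subset_span (Finset.mem_coe.2 (Finset.mem_image_of_mem b hi)))
  refine ⟨S, ?_, ?_, ?_⟩
  · have h1 : LinearMap.range (S : H →ₗ[ℂ] H) ≤ U := by
      rintro _ ⟨ξ, rfl⟩
      exact hU ξ
    refine (Submodule.rank_mono h1).trans ((rank_span_finset_le _).trans ?_)
    exact_mod_cast Finset.card_image_le
  -- `S` factors through the finite-dimensional space `U`, where compactness is automatic.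
  · have : FiniteDimensional ℂ U := FiniteDimensional.span_finset ℂ _
    have : ProperSpace U := FiniteDimensional.proper ℂ U
    have h1 : IsCompactOperator (S.codRestrict U hU) :=
      isCompactOperator_of_locallyCompactSpace_dom _
    exact h1.clm_comp U.subtypeL
  · refine ContinuousLinearMap.opNorm_le_bound _ hε fun ξ => norm_le_mul_norm_of_repr b hε fun i => ?_
    rw [sub_apply, map_sub, lp.coeFn_sub, Pi.sub_apply, repr_diagCLM, repr_diagCLM, ← sub_mul,
      norm_mul]
    refine mul_le_mul_of_nonneg_right ?_ (norm_nonneg _)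
    split_ifs with hi
    · simpa using hε
    · simpa using h i hi

/-- When the entries tend to `0`, finite truncations converge in norm, and compact operators form a
closed set. -/
theorem isCompactOperator_diagCLM [CompleteSpace H] (b : HilbertBasis ι ℂ H) {c : ι → ℂ} {C : ℝ}
    (hC : 0 ≤ C) (hc : ∀ i, ‖c i‖ ≤ C) (h0 : ∀ ε > 0, {i | ε < ‖c i‖}.Finite) :
    IsCompactOperator (diagCLM b hC hc) := by
  have hmem : diagCLM b hC hc ∈ closure {T : H →L[ℂ] H | IsCompactOperator T} := by
    refine Metric.mem_closure_iff.2 fun ε hε => ?_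
    obtain ⟨S, -, hS, hn⟩ := exists_finite_truncation b hC hc (h0 (ε / 2) (half_pos hε)).toFinset
      (half_pos hε).le fun i hi => by simpa using hi
    refine ⟨S, hS, ?_⟩
    rw [dist_eq_norm]
    linarith
  rwa [(isClosed_setOfPred_isCompactOperator (σ₁₂ := RingHom.id ℂ) (M₁ := H) (M₂ := H)).closure_eq]
    at hmem

/-- The graph of the (unbounded) diagonal operator with real eigenvalues `d`. -/
def diagGraph (b : HilbertBasis ι ℂ H) (d : ι → ℝ) : Submodule ℂ (H × H) where
  carrier := {p | ∀ i, b.repr p.2 i = d i * b.repr p.1 i}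
  add_mem' {p q} hp hq i := by
    rw [Prod.snd_add, Prod.fst_add, map_add, map_add, lp.coeFn_add, lp.coeFn_add, Pi.add_apply,
      Pi.add_apply, hp i, hq i, mul_add]
  zero_mem' i := by simp
  smul_mem' a p hp i := by
    rw [Prod.smul_snd, Prod.smul_fst, map_smul, map_smul, lp.coeFn_smul, lp.coeFn_smul,
      Pi.smul_apply, Pi.smul_apply, hp i, smul_eq_mul, smul_eq_mul, mul_left_comm]

theorem mem_diagGraph {b : HilbertBasis ι ℂ H} {d : ι → ℝ} {ξ η : H} :
    (ξ, η) ∈ diagGraph b d ↔ ∀ i, b.repr η i = d i * b.repr ξ i := Iff.rfl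

/-- The self-adjoint diagonal operator with real eigenvalues `d` in the Hilbert basis `b`. -/
noncomputable def diagOp (b : HilbertBasis ι ℂ H) (d : ι → ℝ) : H →ₗ.[ℂ] H :=
  (diagGraph b d).toLinearPMap

theorem graph_diagOp (b : HilbertBasis ι ℂ H) (d : ι → ℝ) :
    (diagOp b d).graph = diagGraph b d :=
  Submodule.toLinearPMap_graph_eq _ fun p hp h0 => ext_repr b fun i => by
    rw [hp i, h0]
    simp

theorem mem_graph_diagOp {b : HilbertBasis ι ℂ H} {d : ι → ℝ} {ξ η : H} :
    (ξ, η) ∈ (diagOp b d).graph ↔ ∀ i, b.repr η i = d i * b.repr ξ i := by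
  rw [graph_diagOp, mem_diagGraph]

theorem repr_diagOp {b : HilbertBasis ι ℂ H} {d : ι → ℝ} (ξ : (diagOp b d).domain) (i : ι) :
    b.repr (diagOp b d ξ) i = d i * b.repr (ξ : H) i :=
  mem_graph_diagOp.1 (LinearPMap.mem_graph _ ξ) i

/-- An element of the graph of a partially defined map gives its value. -/
theorem exists_apply_eq_of_mem_graph {D : H →ₗ.[ℂ] H} {ξ η : H} (h : (ξ, η) ∈ D.graph) :
    ∃ hξ : ξ ∈ D.domain, D ⟨ξ, hξ⟩ = η := by
  obtain ⟨y, hy, hy'⟩ := (LinearPMap.mem_graph_iff D).1 h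
  dsimp only at hy hy'
  subst hy
  exact ⟨y.2, hy'⟩

theorem basis_mem_graph_diagOp (b : HilbertBasis ι ℂ H) (d : ι → ℝ) (i : ι) :
    (b i, (d i : ℂ) • b i) ∈ (diagOp b d).graph := by
  classical
  refine mem_graph_diagOp.2 fun j => ?_
  rw [map_smul, lp.coeFn_smul, Pi.smul_apply, b.repr_self, smul_eq_mul, lp.single_apply]
  by_cases h : j = i
  · subst h; simp
  · simp [h]

theorem dense_domain_diagOp (b : HilbertBasis ι ℂ H) (d : ι → ℝ) :
    Dense ((diagOp b d).domain : Set H) := by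
  rw [Submodule.dense_iff_topologicalClosure_eq_top, ← top_le_iff, ← b.dense_span]
  refine Submodule.topologicalClosure_mono (Submodule.span_le.2 ?_)
  rintro _ ⟨i, rfl⟩
  exact (exists_apply_eq_of_mem_graph (basis_mem_graph_diagOp b d i)).1

/-- Symmetry, because the eigenvalues are real. It serves both for self-adjointness and for the
identification of `D` in `diracGraph_eq`. -/
theorem inner_diagOp (b : HilbertBasis ι ℂ H) (d : ι → ℝ) {ξ η ξ' η' : H}
    (h : (ξ, η) ∈ (diagOp b d).graph) (h' : (ξ', η') ∈ (diagOp b d).graph) :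
    inner ℂ η ξ' = inner ℂ ξ η' := by
  rw [← b.repr.inner_map_map, ← b.repr.inner_map_map ξ, lp.inner_eq_tsum, lp.inner_eq_tsum]
  refine tsum_congr fun i => ?_
  rw [mem_graph_diagOp.1 h, mem_graph_diagOp.1 h', RCLike.inner_apply, RCLike.inner_apply, map_mul,
    Complex.conj_ofReal]
  ring

theorem isSelfAdjoint_diagOp [CompleteSpace H] (b : HilbertBasis ι ℂ H) (d : ι → ℝ) :
    IsSelfAdjoint (diagOp b d) := by
  rw [LinearPMap.isSelfAdjoint_def]
  refine LinearPMap.eq_of_eq_graph ?_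
  rw [LinearPMap.adjoint_graph_eq_graph_adjoint (dense_domain_diagOp b d)]
  ext ⟨ξ, η⟩
  rw [Submodule.mem_adjoint_iff]
  constructor
  -- Pairing with the basis vectors alone already forces the coefficient relations, so the adjoint
  -- is no larger than the operator.
  · intro h
    refine mem_graph_diagOp.2 fun i => ?_
    have := h _ _ (basis_mem_graph_diagOp b d i)
    rw [inner_smul_left, ← b.repr_apply_apply, ← b.repr_apply_apply, Complex.conj_ofReal,
      sub_eq_zero] at this
    exact this.symm
  · intro h ξ' η' h'
    rw [inner_diagOp b d h' h, sub_self]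

theorem isModulus_diagOp [CompleteSpace H] (b : HilbertBasis ι ℂ H) (d : ι → ℝ) :
    IsModulus (diagOp b d) (diagOp b fun i => |d i|) where
  isSelfAdjoint := isSelfAdjoint_diagOp b _
  nonneg ξ := by
    rw [← b.repr.inner_map_map, lp.inner_eq_tsum, Complex.re_tsum (lp.summable_inner _ _)]
    refine tsum_nonneg fun i => ?_
    rw [repr_diagOp, RCLike.inner_apply, mul_assoc, Complex.mul_conj, ← Complex.ofReal_mul,
      Complex.ofReal_re]
    exact mul_nonneg (abs_nonneg _) (Complex.normSq_nonneg _)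
  sq_eq ξ ζ := by
    -- In both directions the intermediate vector is replaced by its image under the bounded sign
    -- operator, since `sign(d)|d| = d` and `sign(d) d = |d|`. The domains of the two squares
    -- therefore agree.
    have hs : ∀ i, ‖((SignType.sign (d i) : ℝ) : ℂ)‖ ≤ 1 := fun i => by
      rcases SignType.trichotomy (SignType.sign (d i)) with h | h | h <;> simp [h]
    simp only [mem_graph_diagOp]
    constructor
    · rintro ⟨η, h1, h2⟩
      refine ⟨diagCLM b zero_le_one hs η, fun i => ?_, fun i => ?_⟩
      · rw [repr_diagCLM, h1, ← mul_assoc, ← Complex.ofReal_mul, sign_mul_abs]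
      · rw [repr_diagCLM, h2, ← mul_assoc, ← Complex.ofReal_mul, self_mul_sign]
    · rintro ⟨η, h1, h2⟩
      refine ⟨diagCLM b zero_le_one hs η, fun i => ?_, fun i => ?_⟩
      · rw [repr_diagCLM, h1, ← mul_assoc, ← Complex.ofReal_mul, sign_mul_self]
      · rw [repr_diagCLM, h2, ← mul_assoc, ← Complex.ofReal_mul, abs_mul_sign]

theorem hasCompactResolvent_diagOp [CompleteSpace H] (b : HilbertBasis ι ℂ H) {d : ι → ℝ}
    (hd : ∀ M, {i | |d i| < M}.Finite) : HasCompactResolvent (diagOp b d) := by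
  -- The spectral parameter is `z = i`: the `d i` being real, `|d i - i|` is at least `1` and at
  -- least `|d i|`.
  have hne : ∀ i, (d i : ℂ) - Complex.I ≠ 0 := fun i h => by
    simpa using congrArg Complex.im h
  have him : ∀ i, 1 ≤ ‖(d i : ℂ) - Complex.I‖ := fun i => by
    simpa using Complex.abs_im_le_norm ((d i : ℂ) - Complex.I)
  have hre : ∀ i, |d i| ≤ ‖(d i : ℂ) - Complex.I‖ := fun i => by
    simpa using Complex.abs_re_le_norm ((d i : ℂ) - Complex.I)
  have hc : ∀ i, ‖((d i : ℂ) - Complex.I)⁻¹‖ ≤ 1 := fun i => by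
    rw [norm_inv]
    exact inv_le_one_of_one_le₀ (him i)
  refine ⟨Complex.I, diagCLM b zero_le_one hc, ?_, fun η => ?_, fun ξ => ?_⟩
  · refine isCompactOperator_diagCLM b zero_le_one hc fun ε hε => (hd ε⁻¹).subset fun i hi => ?_
    rw [Set.mem_ofPred_eq, norm_inv] at hi
    exact (hre i).trans_lt ((lt_inv_comm₀ hε (one_pos.trans_le (him i))).1 hi)
  · have h : (diagCLM b zero_le_one hc η, η + Complex.I • diagCLM b zero_le_one hc η) ∈
        (diagOp b d).graph := mem_graph_diagOp.2 fun i => by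
      rw [map_add, map_smul, lp.coeFn_add, lp.coeFn_smul, Pi.add_apply, Pi.smul_apply, repr_diagCLM,
        smul_eq_mul]
      have := hne i
      field_simp
      ring
    obtain ⟨h1, h2⟩ := exists_apply_eq_of_mem_graph h
    exact ⟨h1, by rw [h2, add_sub_cancel_right]⟩
  · refine ext_repr b fun i => ?_
    rw [repr_diagCLM, map_sub, map_smul, lp.coeFn_sub, lp.coeFn_smul, Pi.sub_apply, Pi.smul_apply,
      repr_diagOp, smul_eq_mul, ← sub_mul, inv_mul_cancel_left₀ (hne i)]

/-- The convention `0⁻¹ = 0` makes the diagonal operator of the inverses vanish on the kernel, as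
the reduced inverse must. -/
theorem isReducedInverse_diagOp [CompleteSpace H] (b : HilbertBasis ι ℂ H) {d : ι → ℝ} {C : ℝ}
    (hC : 0 ≤ C) (hc : ∀ i, ‖((d i : ℂ))⁻¹‖ ≤ C) :
    IsReducedInverse (diagOp b d) (diagCLM b hC hc) := by
  have hker : ∀ i, d i = 0 → ∃ h : b i ∈ (diagOp b d).domain, diagOp b d ⟨b i, h⟩ = 0 :=
    fun i hi => exists_apply_eq_of_mem_graph (by
      have := basis_mem_graph_diagOp b d i
      rwa [hi, Complex.ofReal_zero, zero_smul] at this)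
  have hcoef : ∀ ζ : (diagOp b d).domain, diagOp b d ζ = 0 → ∀ i, d i = 0 ∨ b.repr (ζ : H) i = 0 :=
    fun ζ hζ i => by
      have := repr_diagOp ζ i
      rw [hζ, map_zero, lp.coeFn_zero, Pi.zero_apply, eq_comm, mul_eq_zero] at this
      exact this.imp_left Complex.ofReal_eq_zero.1
  classical
  have hproj : ∀ η : H, ∃ θ : H, ∀ i, b.repr θ i = if d i = 0 then 0 else b.repr η i := fun η => by
    have h1 : ∀ i, ‖(if d i = 0 then 0 else 1 : ℂ)‖ ≤ 1 := fun i => by split_ifs <;> simp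
    exact ⟨diagCLM b zero_le_one h1 η, fun i => by rw [repr_diagCLM]; split_ifs <;> simp⟩
  -- `D R η` is the projection `θ` of `η` onto the orthogonal complement of the kernel.
  have hgraph : ∀ η θ : H, (∀ i, b.repr θ i = if d i = 0 then 0 else b.repr η i) →
      (diagCLM b hC hc η, θ) ∈ (diagOp b d).graph := fun η θ hθ => mem_graph_diagOp.2 fun i => by
    rw [repr_diagCLM, hθ]
    split_ifs with h
    · rw [h]; simp
    · rw [mul_inv_cancel_left₀ (Complex.ofReal_ne_zero.2 h)]
  refine ⟨fun ζ hζ => ext_repr b fun i => ?_, fun η => ?_, fun η ζ hζ => ?_, fun η hη => ?_⟩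
  · rw [repr_diagCLM, map_zero, lp.coeFn_zero, Pi.zero_apply]
    rcases hcoef ζ hζ i with h | h <;> simp [h]
  · obtain ⟨θ, hθ⟩ := hproj η
    exact (exists_apply_eq_of_mem_graph (hgraph η θ hθ)).1
  · rw [← b.repr.inner_map_map, lp.inner_eq_tsum]
    refine (tsum_congr fun i => ?_).trans tsum_zero
    rw [repr_diagCLM]
    rcases hcoef ζ hζ i with h | h <;> simp [h]
  · refine (exists_apply_eq_of_mem_graph (hgraph η η fun i => ?_)).2
    split_ifs with h
    · obtain ⟨h1, h2⟩ := hker i h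
      rw [b.repr_apply_apply]
      exact hη _ h2
    · rfl

theorem characteristicValue_le {T S : H →L[ℂ] H} {k : ℕ}
    (hS : LinearMap.rank (S : H →ₗ[ℂ] H) ≤ k) : characteristicValue T k ≤ ‖T - S‖ :=
  csInf_le ⟨0, by rintro _ ⟨S, -, rfl⟩; exact norm_nonneg _⟩ ⟨S, hS, rfl⟩

/-- A bounded operator composed with an unbounded diagonal one is bounded when its matrix, so
rescaled, is Hilbert-Schmidt. -/
theorem norm_apply_le_of_mem_graph (b : HilbertBasis ι ℂ H) (d : ι → ℝ) (K : H →L[ℂ] H)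
    (hK : Summable fun i => (|d i| * ‖K (b i)‖) ^ 2) :
    ∃ C : ℝ, ∀ ξ η : H, (ξ, η) ∈ (diagOp b d).graph → ‖K η‖ ≤ C * ‖ξ‖ := by
  have hn : ∀ i, ‖((|d i| * ‖K (b i)‖ : ℝ) : ℂ)‖ = |d i| * ‖K (b i)‖ := fun i => by
    rw [Complex.norm_real, Real.norm_of_nonneg (by positivity)]
  have hmem : Memℓp (fun i => ((|d i| * ‖K (b i)‖ : ℝ) : ℂ)) 2 :=
    (memℓp_gen_iff (by simp)).2 (hK.congr fun i => by
      rw [hn, ENNReal.toReal_ofNat, Real.rpow_two])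
  set a : lp (fun _ : ι => ℂ) 2 := ⟨_, hmem⟩
  refine ⟨‖a‖, fun ξ η h => ?_⟩
  -- Cauchy-Schwarz applied to `K η = ∑ d_i ξ_i K(b_i)`, where `ξ_i` are the coefficients of `ξ`.
  have hpq : (2 : ℝ≥0∞).toReal.HolderConjugate (2 : ℝ≥0∞).toReal := by
    rw [ENNReal.toReal_ofNat]
    exact Real.HolderConjugate.two_two
  obtain ⟨h1, h2⟩ := lp.tsum_mul_le_mul_norm hpq a (b.repr ξ)
  have hs : HasSum (fun i => b.repr η i • K (b i)) (K η) := by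
    simpa using (b.hasSum_repr η).mapL K
  rw [b.repr.norm_map] at h2
  refine le_trans ?_ h2
  refine hs.norm_le_of_bounded h1.hasSum fun i => le_of_eq ?_
  change _ = ‖((|d i| * ‖K (b i)‖ : ℝ) : ℂ)‖ * _
  rw [hn, norm_smul, mem_graph_diagOp.1 h, norm_mul, Complex.norm_real, Real.norm_eq_abs]
  ring

/-- The twisted commutator with `|D|` is bounded when the one with `D` is and the commutator with
the sign of `D`, composed with `D`, is Hilbert-Schmidt. -/
theorem HasBoundedTwistedCommutator.abs_diagOp (b : HilbertBasis ι ℂ H) {d : ι → ℝ}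
    {S T : H →L[ℂ] H} (h : HasBoundedTwistedCommutator (diagOp b d) S T) {F : H →L[ℂ] H}
    (hF : ∀ ξ i, b.repr (F ξ) i = (SignType.sign (d i) : ℝ) * b.repr ξ i)
    (hK : Summable fun i => (|d i| * ‖(F * T - T * F) (b i)‖) ^ 2) :
    HasBoundedTwistedCommutator (diagOp b fun i => |d i|) S T := by
  obtain ⟨C, hC⟩ := h
  obtain ⟨C', hC'⟩ := norm_apply_le_of_mem_graph b d _ hK
  have hgraph : ∀ {ξ η : H}, (ξ, η) ∈ (diagOp b d).graph →
      (ξ, F η) ∈ (diagOp b fun i => |d i|).graph := fun {ξ η} h => mem_graph_diagOp.2 fun i => by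
    rw [hF, mem_graph_diagOp.1 h, ← mul_assoc, ← Complex.ofReal_mul, sign_mul_self]
  -- `D = F|D|` shows that the domain of `|D|` lies in that of `D`; `hgraph` is the relation `|D| =
  -- F D`.
  have hdom : ∀ ξ : (diagOp b fun i => |d i|).domain, ∃ η, ((ξ : H), η) ∈ (diagOp b d).graph :=
    fun ξ => ⟨F (diagOp b (fun i => |d i|) ξ), mem_graph_diagOp.2 fun i => by
      rw [hF, repr_diagOp, ← mul_assoc, ← Complex.ofReal_mul, sign_mul_abs]⟩
  refine ⟨‖F‖ * C + C', fun ξ => ?_⟩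
  obtain ⟨η, hη⟩ := hdom ξ
  obtain ⟨hξ, hDξ⟩ := exists_apply_eq_of_mem_graph hη
  obtain ⟨hS, hle⟩ := hC ⟨ξ, hξ⟩
  obtain ⟨h1, h2⟩ := exists_apply_eq_of_mem_graph (hgraph (LinearPMap.mem_graph _ ⟨S ξ, hS⟩))
  obtain ⟨h3, h4⟩ := exists_apply_eq_of_mem_graph (hgraph hη)
  refine ⟨h1, ?_⟩
  dsimp only at h2 hle ⊢
  rw [hDξ] at hle
  have h5 : diagOp b (fun i => |d i|) ξ = F η := h4
  rw [h2, h5]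
  -- With `η = Dξ` this is `|D|S - T|D| = F(DS - TD) + (FT - TF)D`.
  have h6 : F (diagOp b d ⟨S ξ, hS⟩) - T (F η) =
      F (diagOp b d ⟨S ξ, hS⟩ - T η) + (F * T - T * F) η := by
    rw [map_sub, sub_apply, mul_apply_eq_comp, mul_apply_eq_comp]
    abel
  rw [h6, add_mul, mul_assoc]
  refine (norm_add_le _ _).trans (add_le_add ?_ (hC' _ _ hη))
  exact (F.le_opNorm _).trans (mul_le_mul_of_nonneg_left hle (norm_nonneg _))

theorem HasBoundedTwistedCommutator.add {D : H →ₗ.[ℂ] H} {S T S' T' : H →L[ℂ] H}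
    (h : HasBoundedTwistedCommutator D S T) (h' : HasBoundedTwistedCommutator D S' T') :
    HasBoundedTwistedCommutator D (S + S') (T + T') := by
  obtain ⟨C, hC⟩ := h
  obtain ⟨C', hC'⟩ := h'
  refine ⟨C + C', fun ξ => ?_⟩
  obtain ⟨h1, h2⟩ := hC ξ
  obtain ⟨h3, h4⟩ := hC' ξ
  refine ⟨D.domain.add_mem h1 h3, ?_⟩
  have : D ⟨(S + S') ξ, D.domain.add_mem h1 h3⟩ = D ⟨S ξ, h1⟩ + D ⟨S' ξ, h3⟩ :=
    D.map_add ⟨S ξ, h1⟩ ⟨S' ξ, h3⟩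
  rw [this, add_apply, add_sub_add_comm, add_mul]
  exact (norm_add_le _ _).trans (add_le_add h2 h4)

end Diagonal

/-! ### Calculus of smooth functions on the circle and their classes in `L²`. -/

section SmoothFunctions

theorem SmoothCircle.hasDerivAt (f : SmoothCircle) (t : ℝ) :
    HasDerivAt (fun s : ℝ => f.1 (s : UnitAddCircle)) (f.deriv.1 (t : UnitAddCircle)) t := by
  have h : f.deriv.1 (t : UnitAddCircle) = _root_.deriv (fun s : ℝ => f.1 (s : UnitAddCircle)) t := by
    have := deriv_comp_const_add (fun s : ℝ => f.1 (s : UnitAddCircle)) t 0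
    change _root_.deriv (fun s : ℝ => f.1 ((t : UnitAddCircle) + (s : UnitAddCircle))) 0 = _
    simpa using this
  rw [h]
  exact (f.contDiff.differentiable (by simp) t).hasDerivAt

theorem SmoothCircle.deriv_eq {f g : SmoothCircle}
    (h : ∀ t : ℝ, HasDerivAt (fun s : ℝ => f.1 (s : UnitAddCircle)) (g.1 (t : UnitAddCircle)) t) :
    f.deriv = g := SmoothCircle.ext fun x => by
  obtain ⟨t, rfl⟩ := QuotientAddGroup.mk_surjective x
  exact (f.hasDerivAt t).unique (h t)

theorem SmoothCircle.add_apply (f g : SmoothCircle) (x : UnitAddCircle) :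
    (f + g).1 x = f.1 x + g.1 x := rfl

theorem SmoothCircle.mul_apply (f g : SmoothCircle) (x : UnitAddCircle) :
    (f * g).1 x = f.1 x * g.1 x := rfl

theorem SmoothCircle.smul_apply (c : ℂ) (f : SmoothCircle) (x : UnitAddCircle) :
    (c • f).1 x = c * f.1 x := rfl

theorem SmoothCircle.star_apply (f : SmoothCircle) (x : UnitAddCircle) :
    (star f).1 x = star (f.1 x) := rfl

theorem SmoothCircle.deriv_mul (f g : SmoothCircle) :
    (f * g).deriv = f.deriv * g + f * g.deriv :=
  SmoothCircle.deriv_eq fun t => (f.hasDerivAt t).mul (g.hasDerivAt t)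

theorem SmoothCircle.deriv_add (f g : SmoothCircle) : (f + g).deriv = f.deriv + g.deriv :=
  SmoothCircle.deriv_eq fun t => (f.hasDerivAt t).add (g.hasDerivAt t)

theorem SmoothCircle.deriv_smul (c : ℂ) (f : SmoothCircle) : (c • f).deriv = c • f.deriv :=
  SmoothCircle.deriv_eq fun t => (f.hasDerivAt t).const_mul c

theorem SmoothCircle.deriv_star (f : SmoothCircle) : (star f).deriv = star f.deriv :=
  SmoothCircle.deriv_eq fun t => (f.hasDerivAt t).star

theorem deriv_diff_smul (φ : DiffCircle) (f : SmoothCircle) :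
    (φ • f).deriv = jacFun φ⁻¹ * φ • f.deriv := by
  refine SmoothCircle.deriv_eq fun t => ?_
  obtain ⟨hs, -, hc⟩ := isSmoothLift_smoothLift φ⁻¹
  have h1 := f.hasDerivAt (smoothLift φ⁻¹ t)
  have h2 := h1.scomp t (hs.differentiable (by simp) t).hasDerivAt
  rw [← jac_coe, hc] at h2
  have h3 : (fun s : ℝ => (φ • f).1 (s : UnitAddCircle)) =
      (fun s : ℝ => f.1 (s : UnitAddCircle)) ∘ smoothLift φ⁻¹ := funext fun s => by
    rw [smul_smoothCircle_apply, ← hc]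
    rfl
  rw [h3, SmoothCircle.mul_apply, jacFun_apply, smul_smoothCircle_apply]
  simpa using h2

theorem haarAddCircle_eq_volume : (haarAddCircle : Measure UnitAddCircle) = volume := by
  rw [AddCircle.volume_eq_smul_haarAddCircle]; simp

theorem SmoothCircle.integral_deriv (f : SmoothCircle) :
    ∫ x, f.deriv.1 x ∂haarAddCircle = 0 := by
  rw [haarAddCircle_eq_volume, ← UnitAddCircle.intervalIntegral_preimage 0,
    intervalIntegral.integral_eq_sub_of_hasDerivAt (fun t _ => f.hasDerivAt t)
      ((f.deriv.contDiff.continuous).intervalIntegrable _ _)]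
  rw [zero_add, sub_eq_zero]
  -- The endpoints `0` and `1` are the same point of the circle.
  congr 1
  exact AddCircle.coe_period 1

theorem SmoothCircle.integrable (f : SmoothCircle) :
    Integrable f.1 (haarAddCircle : Measure UnitAddCircle) :=
  f.1.continuous.integrable_of_hasCompactSupport (HasCompactSupport.of_compactSpace _)

theorem SmoothCircle.integral_mul_deriv (f g : SmoothCircle) :
    ∫ x, f.1 x * g.deriv.1 x ∂haarAddCircle = -∫ x, f.deriv.1 x * g.1 x ∂haarAddCircle := by
  have h := (f * g).integral_deriv
  rw [SmoothCircle.deriv_mul] at h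
  rw [eq_neg_iff_add_eq_zero, add_comm, ← h]
  exact (integral_add (f.deriv * g).integrable (f * g.deriv).integrable).symm

/-- The character `e^{2πinx}` as a smooth function. -/
noncomputable def fourierSmooth (n : ℤ) : SmoothCircle :=
  SmoothCircle.mk (fourier n) (by
    simp only [fourier_coe_apply]
    have : ContDiff ℝ ∞ fun t : ℝ => (t : ℂ) := Complex.ofRealCLM.contDiff
    fun_prop)

theorem deriv_fourierSmooth (n : ℤ) :
    (fourierSmooth n).deriv = (2 * Real.pi * Complex.I * n : ℂ) • fourierSmooth n :=
  SmoothCircle.deriv_eq fun t => by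
    have := hasDerivAt_fourier 1 n t
    rw [Complex.ofReal_one, div_one] at this
    exact this

/-- The class of a smooth function in `L²(S¹)`. -/
noncomputable def SmoothCircle.toL2 (f : SmoothCircle) : L2Circle :=
  ContinuousMap.toLp 2 haarAddCircle ℂ f.1

theorem SmoothCircle.toL2_ae (f : SmoothCircle) : f.toL2 =ᵐ[haarAddCircle] f.1 :=
  ContinuousMap.coeFn_toLp (𝕜 := ℂ) haarAddCircle f.1

theorem inner_toL2_star (f : SmoothCircle) (ξ : L2Circle) :
    inner ℂ (star f).toL2 ξ = ∫ x, ξ x * f.1 x ∂haarAddCircle := by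
  rw [L2.inner_def]
  refine integral_congr_ae ?_
  filter_upwards [(star f).toL2_ae] with x hx
  rw [hx, RCLike.inner_apply, SmoothCircle.star_apply]
  change _ * (starRingEnd ℂ) ((starRingEnd ℂ) _) = _
  rw [Complex.conj_conj]

theorem toL2_smul (c : ℂ) (f : SmoothCircle) : (c • f).toL2 = c • f.toL2 :=
  (ContinuousMap.toLp 2 haarAddCircle ℂ (E := ℂ)).map_smul c f.1

/-- Integration by parts. Smooth functions supply the vectors against which the diagonal operator is
tested in `diracGraph_eq`. -/
theorem toL2_mem_diracGraph (f : SmoothCircle) :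
    (f.toL2, ((-Complex.I) • f.deriv).toL2) ∈ diracGraph := fun g => by
  have h1 : ∫ x, ((-Complex.I) • f.deriv).toL2 x * g.1 x ∂haarAddCircle =
      ∫ x, -Complex.I * (f.deriv.1 x * g.1 x) ∂haarAddCircle := by
    refine integral_congr_ae ?_
    filter_upwards [((-Complex.I) • f.deriv).toL2_ae] with x hx
    rw [hx, SmoothCircle.smul_apply, mul_assoc]
  have h2 : ∫ x, f.toL2 x * g.deriv.1 x ∂haarAddCircle =
      ∫ x, f.1 x * g.deriv.1 x ∂haarAddCircle := by
    refine integral_congr_ae ?_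
    filter_upwards [f.toL2_ae] with x hx
    rw [hx]
  dsimp only
  rw [h1, h2, integral_const_mul, SmoothCircle.integral_mul_deriv]
  ring

end SmoothFunctions

/-! ### Diagonalization of `D` by Fourier series, and summability. -/

section DiracSpectrum

/-- The eigenvalues of the Dirac operator. -/
noncomputable def diracEigenvalue (n : ℤ) : ℝ := 2 * Real.pi * n

theorem fourierBasis_repr_eq_integral (ξ : L2Circle) (n : ℤ) :
    fourierBasis.repr ξ n = ∫ x, ξ x * (fourierSmooth (-n)).1 x ∂haarAddCircle := by
  rw [fourierBasis_repr, fourierCoeff]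
  exact integral_congr_ae (Filter.Eventually.of_forall fun x => mul_comm _ _)

/-- The weak-derivative identity for the test function `e_{-n}` is precisely the relation between
the `n`-th Fourier coefficients. -/
theorem diracGraph_le : diracGraph ≤ diagGraph fourierBasis diracEigenvalue := fun p hp n => by
  rw [fourierBasis_repr_eq_integral, fourierBasis_repr_eq_integral, hp, deriv_fourierSmooth,
    ← integral_const_mul, ← integral_const_mul]
  refine integral_congr_ae (Filter.Eventually.of_forall fun x => ?_)
  simp only [SmoothCircle.smul_apply, diracEigenvalue]
  push_cast
  linear_combination (-2 * Real.pi * n * p.1 x * (fourierSmooth (-n)).1 x) * Complex.I_mul_I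

/-- For the converse, symmetry of the diagonal operator, applied to a pair of its graph and to the
smooth function `star f`, is the weak-derivative identity with test function `f`. -/
theorem diracGraph_eq : diracGraph = diagGraph fourierBasis diracEigenvalue := by
  refine le_antisymm diracGraph_le fun p hp f => ?_
  have h := inner_diagOp fourierBasis diracEigenvalue
    (mem_graph_diagOp.2 (diracGraph_le (toL2_mem_diracGraph (star f))))
    (mem_graph_diagOp.2 hp)
  rw [inner_toL2_star, SmoothCircle.deriv_star, toL2_smul, inner_smul_left, inner_toL2_star] at h
  rw [← h]
  simp

theorem dirac_eq_diagOp : dirac = diagOp fourierBasis diracEigenvalue :=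
  LinearPMap.eq_of_eq_graph (by rw [graph_dirac, graph_diagOp, diracGraph_eq])

theorem finite_abs_diracEigenvalue_lt (M : ℝ) : {n : ℤ | |diracEigenvalue n| < M}.Finite := by
  refine (Set.finite_Icc (-⌈M⌉) ⌈M⌉).subset fun n hn => ?_
  rw [Set.mem_ofPred_eq, diracEigenvalue, abs_mul, abs_of_pos Real.two_pi_pos] at hn
  have h1 : |(n : ℝ)| ≤ M := by
    nlinarith [Real.pi_gt_three, abs_nonneg (n : ℝ)]
  have h2 : |(n : ℝ)| ≤ ⌈M⌉ := h1.trans (Int.le_ceil M)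
  have h3 : |n| ≤ ⌈M⌉ := by exact_mod_cast h2
  exact abs_le.1 h3

/-- The `6` comes from `2π > 6`. The case `n = 0` is harmless because `0⁻¹ = 0`. -/
theorem norm_inv_diracEigenvalue_le {n : ℤ} {r : ℝ} (hr : 0 < r) (h : n = 0 ∨ r ≤ |(n : ℝ)|) :
    ‖((diracEigenvalue n : ℂ))⁻¹‖ ≤ (6 * r)⁻¹ := by
  rw [norm_inv, Complex.norm_real, diracEigenvalue, norm_mul, Real.norm_of_nonneg Real.two_pi_pos.le,
    Real.norm_eq_abs]
  rcases h with rfl | h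
  · simp only [Int.cast_zero, abs_zero, mul_zero, inv_zero]
    positivity
  · refine inv_anti₀ (by positivity) ?_
    have := Real.pi_gt_three
    gcongr
    linarith

theorem norm_inv_diracEigenvalue_le_one (n : ℤ) : ‖((diracEigenvalue n : ℂ))⁻¹‖ ≤ 1 := by
  refine (norm_inv_diracEigenvalue_le one_pos ?_).trans (by norm_num)
  by_cases h : n = 0
  · exact Or.inl h
  · exact Or.inr (by exact_mod_cast Int.one_le_abs h)

theorem isFinitelySummable_dirac : IsFinitelySummable 1 dirac := by
  rw [dirac_eq_diagOp]
  refine ⟨diagCLM fourierBasis zero_le_one norm_inv_diracEigenvalue_le_one,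
    isReducedInverse_diagOp _ _ _, ?_, 1, fun k => ?_⟩
  · refine isCompactOperator_diagCLM _ _ _ fun ε hε =>
      (finite_abs_diracEigenvalue_lt ε⁻¹).subset fun n hn => ?_
    rw [Set.mem_ofPred_eq, norm_inv, Complex.norm_real, Real.norm_eq_abs] at hn
    have hpos : 0 < |diracEigenvalue n| := inv_pos.1 (hε.trans hn)
    exact (lt_inv_comm₀ hε hpos).1 hn
  · have hk : (0 : ℝ) < k + 1 := by positivity
    -- Keep the nonzero frequencies with `|n| ≤ ⌊k/2⌋`: there are `2⌊k/2⌋ ≤ k` of them, `0` being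
    -- dropped because its entry vanishes. The other nonzero `n` satisfy `|n| ≥ (k+1)/2`, so the
    -- error is at most `1/(3(k+1))`.
    obtain ⟨S, hS, -, hle⟩ := exists_finite_truncation
      (fourierBasis : HilbertBasis ℤ ℂ L2Circle) zero_le_one
      norm_inv_diracEigenvalue_le_one
      (((Finset.Icc (-(k / 2 : ℤ)) (k / 2 : ℤ)).erase 0)) (ε := (6 * ((k + 1) / 2 : ℝ))⁻¹)
      (by positivity) fun n hn => norm_inv_diracEigenvalue_le (by positivity) (by
        rw [Finset.mem_erase, Finset.mem_Icc, not_and_or, not_not] at hn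
        refine hn.imp_right fun h => ?_
        have h1 : (k : ℤ) + 1 ≤ 2 * |n| := by rcases abs_cases n with h' | h' <;> omega
        have h2 : (k : ℝ) + 1 ≤ 2 * |(n : ℝ)| := by exact_mod_cast h1
        linarith)
    have hcard : ((Finset.Icc (-(k / 2 : ℤ)) (k / 2 : ℤ)).erase 0).card ≤ k := by
      rw [Finset.card_erase_of_mem (Finset.mem_Icc.2 (by omega)), Int.card_Icc]
      omega
    refine (characteristicValue_le (hS.trans (by exact_mod_cast hcard))).trans (hle.trans ?_)
    rw [div_one, Real.rpow_neg_one, one_mul]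
    refine inv_anti₀ hk (by linarith)

end DiracSpectrum

/-! ### Boundedness of the twisted commutators with `D`, and the compatibility of `σ` with the
involution. -/

section TwistedCommutators

theorem jac_inv_apply (φ : DiffCircle) (x : UnitAddCircle) :
    jac φ⁻¹ x = (jac φ (φ⁻¹.1 x))⁻¹ := by
  have h := jac_mul φ φ⁻¹ x
  rw [mul_inv_cancel, jac_one] at h
  exact eq_inv_of_mul_eq_one_right h.symm

theorem integral_jac_smul (φ : DiffCircle) (h : UnitAddCircle → ℂ) :
    ∫ x, jac φ x • h (φ.1 x) ∂haarAddCircle = ∫ x, h x ∂haarAddCircle := by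
  have hm : Measurable fun x => ENNReal.ofReal (jac φ x) :=
    (continuous_jac φ).measurable.ennreal_ofReal
  let e : UnitAddCircle ≃ₜ UnitAddCircle :=
    { φ.1 with
      continuous_toFun := continuous_diff φ
      continuous_invFun := continuous_diff φ⁻¹ }
  -- The push-forward of `φ' dx` under `φ` is `dx`. This carries the change of variables from
  -- nonnegative to complex functions, with no measurability assumption on `h`.
  have hmap : ((haarAddCircle : Measure UnitAddCircle).withDensity
      fun x => ENNReal.ofReal (jac φ x)).map e = haarAddCircle := by
    ext s hs
    rw [Measure.map_apply e.measurable hs, withDensity_apply _ (e.measurable hs),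
      ← lintegral_indicator (e.measurable hs), ← lintegral_indicator_one hs,
      ← lintegral_jac_mul φ (s.indicator 1)]
    refine lintegral_congr fun x => ?_
    by_cases hx : φ.1 x ∈ s
    · have : x ∈ e ⁻¹' s := hx
      simp [hx, this]
    · have : x ∉ e ⁻¹' s := hx
      simp [hx, this]
  conv_rhs => rw [← hmap]
  rw [e.measurableEmbedding.integral_map,
    integral_withDensity_eq_integral_toReal_smul hm (by simp)]
  refine integral_congr_ae (Filter.Eventually.of_forall fun x => ?_)
  dsimp only
  rw [ENNReal.toReal_ofReal (jac_pos φ x).le]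
  rfl

/-- The change of variables `y = φ(x)` gives the transpose of a weighted composition operator, which
moves the operator onto the test function. -/
theorem integral_weighted_mul (φ : DiffCircle) (w f : SmoothCircle) (ξ : L2Circle) :
    ∫ x, weighted w.1 φ ξ x * f.1 x ∂haarAddCircle =
      ∫ x, ξ x * (φ • (jacInvFun φ * (w * f))).1 x ∂haarAddCircle := by
  rw [← integral_jac_smul φ fun x => ξ x * (φ • (jacInvFun φ * (w * f))).1 x]
  refine integral_congr_ae ?_
  filter_upwards [weighted_ae w.1 φ ξ] with x hx
  have hj : (jac φ x : ℂ) ≠ 0 := Complex.ofReal_ne_zero.2 (jac_pos φ x).ne'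
  have hφ : φ⁻¹.1 (φ.1 x) = x := φ.1.symm_apply_apply x
  rw [hx, smul_smoothCircle_apply, hφ, SmoothCircle.mul_apply, SmoothCircle.mul_apply,
    jacInvFun_apply, Complex.ofReal_inv, Complex.real_smul]
  field_simp

/-- Weighted composition operators preserve the domain of `D`, by the Leibniz and chain rules. -/
theorem weighted_mem_diracGraph (φ : DiffCircle) (w : SmoothCircle) {ξ η : L2Circle}
    (h : (ξ, η) ∈ diracGraph) :
    (weighted w.1 φ ξ, weighted ((-Complex.I) • w.deriv).1 φ ξ + weighted (jacFun φ * w).1 φ η) ∈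
      diracGraph := fun f => by
  have hj : ∀ v : SmoothCircle, jacFun φ⁻¹ * φ • v = φ • (jacInvFun φ * v) := fun v =>
    SmoothCircle.ext fun x => by
      rw [SmoothCircle.mul_apply, jacFun_apply, smul_smoothCircle_apply, smul_smoothCircle_apply,
        SmoothCircle.mul_apply, jacInvFun_apply, jac_inv_apply]
  have hc : φ • (jacInvFun φ * (jacFun φ * w * f)) = φ • (w * f) := by
    congr 1
    refine SmoothCircle.ext fun x => ?_
    have hj : (jac φ x : ℂ) ≠ 0 := Complex.ofReal_ne_zero.2 (jac_pos φ x).ne'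
    simp only [SmoothCircle.mul_apply, jacInvFun_apply, jacFun_apply, Complex.ofReal_inv]
    field_simp
  -- The transposed test function is `(wf) ∘ φ⁻¹`. By the chain rule its derivative is `((wf)'/φ') ∘
  -- φ⁻¹`; the Leibniz rule for `(wf)'` yields the term in `w'`.
  have h1 := h (φ • (w * f))
  rw [deriv_diff_smul, hj, SmoothCircle.deriv_mul] at h1
  have h2 : ∫ x, (weighted ((-Complex.I) • w.deriv).1 φ ξ + weighted (jacFun φ * w).1 φ η : L2Circle)
        x * f.1 x ∂haarAddCircle =
      ∫ x, weighted ((-Complex.I) • w.deriv).1 φ ξ x * f.1 x ∂haarAddCircle +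
        ∫ x, weighted (jacFun φ * w).1 φ η x * f.1 x ∂haarAddCircle := by
    rw [← integral_add (integrable_mul _ f) (integrable_mul _ f)]
    refine integral_congr_ae ?_
    filter_upwards [Lp.coeFn_add (weighted ((-Complex.I) • w.deriv).1 φ ξ)
      (weighted (jacFun φ * w).1 φ η)] with x hx
    rw [hx, Pi.add_apply, add_mul]
  dsimp only at h1 ⊢
  rw [h2, integral_weighted_mul, integral_weighted_mul, integral_weighted_mul, hc, h1,
    ← integral_const_mul, ← integral_const_mul, ← integral_add (integrable_mul _ _)
      ((integrable_mul _ _).const_mul _)]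
  refine integral_congr_ae (Filter.Eventually.of_forall fun x => ?_)
  simp only [smul_smoothCircle_apply, SmoothCircle.mul_apply, SmoothCircle.add_apply,
    SmoothCircle.smul_apply]
  ring

theorem hasBoundedTwistedCommutator_weighted (φ : DiffCircle) (w : SmoothCircle) :
    HasBoundedTwistedCommutator dirac (weighted w.1 φ) (weighted (jacFun φ * w).1 φ) := by
  refine ⟨‖weighted ((-Complex.I) • w.deriv).1 φ‖, fun ξ => ?_⟩
  have hξ : ((ξ : L2Circle), dirac ξ) ∈ diracGraph := by
    rw [← graph_dirac]
    exact LinearPMap.mem_graph _ ξ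
  have h := weighted_mem_diracGraph φ w hξ
  rw [← graph_dirac] at h
  obtain ⟨h1, h2⟩ := exists_apply_eq_of_mem_graph h
  refine ⟨h1, ?_⟩
  -- The term in `Dξ` cancels exactly against `T(Dξ)`, leaving the weighted composition operator
  -- with weight `-i w'`.
  rw [h2, add_sub_cancel_right]
  exact ContinuousLinearMap.le_opNorm _ _

/-- The square root of the Jacobian as a smooth function. -/
noncomputable def sqrtJacFun (φ : DiffCircle) : SmoothCircle :=
  SmoothCircle.mk (fun x => (Real.sqrt (jac φ x) : ℂ)) (Complex.ofRealCLM.contDiff.comp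
    ((contDiff_jac φ).sqrt fun _ => (jac_pos φ _).ne'))

theorem rep_single {Γ : Subgroup DiffCircle} (γ : Γ) (f : SmoothCircle) :
    rep Γ (SkewMonoidAlgebra.single γ f) = weighted (f * sqrtJacFun γ.1⁻¹).1 γ.1⁻¹ :=
  piAlgHom_single γ f

theorem sigma_single {Γ : Subgroup DiffCircle} (γ : Γ) (f : SmoothCircle) :
    sigma Γ (SkewMonoidAlgebra.single γ f) = SkewMonoidAlgebra.single γ (jacFun γ.1⁻¹ * f) := by
  change sigmaHom Γ _ = _
  rw [sigmaHom, twist_single]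

theorem sigma_symm_single {Γ : Subgroup DiffCircle} (γ : Γ) (f : SmoothCircle) :
    (sigma Γ).symm (SkewMonoidAlgebra.single γ f) =
      SkewMonoidAlgebra.single γ (jacInvFun γ.1⁻¹ * f) := by
  change sigmaInvHom Γ _ = _
  rw [sigmaInvHom, twist_single]

/-- On monomials this reduces to `(φ⁻¹)' = 1/(φ' ∘ φ⁻¹)` and the reality of `φ'`. -/
theorem sigma_star {Γ : Subgroup DiffCircle} (a : CrossedProduct Γ) :
    sigma Γ (star a) = star ((sigma Γ).symm a) := by
  induction a using SkewMonoidAlgebra.induction_on' with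
  | add a b ha hb => rw [star_add, map_add, map_add, star_add, ha, hb]
  | single γ f =>
    rw [star_single, sigma_single, sigma_symm_single, star_single]
    congr 1
    refine SmoothCircle.ext fun x => ?_
    change (jac ((γ⁻¹ : Γ) : DiffCircle)⁻¹ x : ℂ) * star (f.1 ((γ.1⁻¹)⁻¹.1 x)) =
      star ((((jac γ.1⁻¹ ((γ.1⁻¹)⁻¹.1 x))⁻¹ : ℝ) : ℂ) * f.1 ((γ.1⁻¹)⁻¹.1 x))
    rw [star_mul', ← jac_inv_apply, InvMemClass.coe_inv]
    congr 1
    exact (Complex.conj_ofReal _).symm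

/-- A bound for the twisted commutators with weighted composition operators gives one for all
elements of the crossed product. -/
theorem hasBoundedTwistedCommutator_rep {D : L2Circle →ₗ.[ℂ] L2Circle}
    (h : ∀ (φ : DiffCircle) (w : SmoothCircle),
      HasBoundedTwistedCommutator D (weighted w.1 φ) (weighted (jacFun φ * w).1 φ))
    {Γ : Subgroup DiffCircle} (a : CrossedProduct Γ) :
    HasBoundedTwistedCommutator D (rep Γ a) (rep Γ (sigma Γ a)) := by
  induction a using SkewMonoidAlgebra.induction_on' with
  | add a b ha hb =>
    rw [map_add, map_add, map_add]
    exact ha.add hb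
  | single γ f =>
    rw [sigma_single, rep_single, rep_single, mul_assoc]
    exact h _ _

end TwistedCommutators

/-! ### Families of smooth functions with uniform derivative bounds, and non-stationary phase. -/

section UniformlyBoundedFamilies

variable {ι : Type*}

/-- A family of smooth functions whose derivatives up to order `k` are uniformly bounded. -/
def BoundedToOrder : ℕ → (ι → SmoothCircle) → Prop
  | 0, u => ∃ C : ℝ, ∀ i x, ‖(u i).1 x‖ ≤ C
  | k + 1, u => (∃ C : ℝ, ∀ i x, ‖(u i).1 x‖ ≤ C) ∧ BoundedToOrder k fun i => (u i).deriv

theorem BoundedToOrder.bounded {k : ℕ} {u : ι → SmoothCircle} (h : BoundedToOrder k u) :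
    ∃ C : ℝ, ∀ i x, ‖(u i).1 x‖ ≤ C := by
  cases k with
  | zero => exact h
  | succ k => exact h.1

theorem BoundedToOrder.of_succ {k : ℕ} {u : ι → SmoothCircle} (h : BoundedToOrder (k + 1) u) :
    BoundedToOrder k u := by
  induction k generalizing u with
  | zero => exact h.bounded
  | succ k ih => exact ⟨h.1, ih h.2⟩

theorem exists_bound_mul {u v : ι → SmoothCircle} (hu : ∃ C : ℝ, ∀ i x, ‖(u i).1 x‖ ≤ C)
    (hv : ∃ C : ℝ, ∀ i x, ‖(v i).1 x‖ ≤ C) : ∃ C : ℝ, ∀ i x, ‖(u i * v i).1 x‖ ≤ C := by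
  obtain ⟨C, hC⟩ := hu
  obtain ⟨C', hC'⟩ := hv
  refine ⟨C * C', fun i x => ?_⟩
  rw [SmoothCircle.mul_apply, norm_mul]
  exact mul_le_mul (hC i x) (hC' i x) (norm_nonneg _) ((norm_nonneg _).trans (hC i x))

theorem exists_bound_add {u v : ι → SmoothCircle} (hu : ∃ C : ℝ, ∀ i x, ‖(u i).1 x‖ ≤ C)
    (hv : ∃ C : ℝ, ∀ i x, ‖(v i).1 x‖ ≤ C) : ∃ C : ℝ, ∀ i x, ‖(u i + v i).1 x‖ ≤ C := by
  obtain ⟨C, hC⟩ := hu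
  obtain ⟨C', hC'⟩ := hv
  exact ⟨C + C', fun i x => (norm_add_le _ _).trans (add_le_add (hC i x) (hC' i x))⟩

theorem BoundedToOrder.add {k : ℕ} {u v : ι → SmoothCircle} (hu : BoundedToOrder k u)
    (hv : BoundedToOrder k v) : BoundedToOrder k fun i => u i + v i := by
  induction k generalizing u v with
  | zero => exact exists_bound_add hu hv
  | succ k ih =>
    refine ⟨exists_bound_add hu.1 hv.1, ?_⟩
    simp only [SmoothCircle.deriv_add]
    exact ih hu.2 hv.2

theorem BoundedToOrder.mul {k : ℕ} {u v : ι → SmoothCircle} (hu : BoundedToOrder k u)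
    (hv : BoundedToOrder k v) : BoundedToOrder k fun i => u i * v i := by
  induction k generalizing u v with
  | zero => exact exists_bound_mul hu hv
  | succ k ih =>
    refine ⟨exists_bound_mul hu.1 hv.1, ?_⟩
    simp only [SmoothCircle.deriv_mul]
    exact (ih hu.2 hv.of_succ).add (ih hu.of_succ hv.2)

theorem boundedToOrder_smul {c : ι → ℂ} (hc : ∀ i, ‖c i‖ ≤ 1) (f : SmoothCircle) (k : ℕ) :
    BoundedToOrder k fun i => c i • f := by
  have h0 : ∀ g : SmoothCircle, ∃ C : ℝ, ∀ i x, ‖(c i • g).1 x‖ ≤ C := fun g =>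
    ⟨1 * ‖g.1‖, fun i x => by
      rw [SmoothCircle.smul_apply, norm_mul]
      exact mul_le_mul (hc i) (g.1.norm_coe_le_norm x) (norm_nonneg _) zero_le_one⟩
  induction k generalizing f with
  | zero => exact h0 f
  | succ k ih =>
    refine ⟨h0 f, ?_⟩
    simp only [SmoothCircle.deriv_smul]
    exact ih f.deriv

/-- A uniformly bounded family of inverses is as regular as the original family. -/
theorem BoundedToOrder.inv {g q : ι → SmoothCircle} (hg : ∀ k, BoundedToOrder k g)
    (hq : BoundedToOrder 0 q) (hgq : ∀ i, q i * g i = 1) (k : ℕ) : BoundedToOrder k q := by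
  induction k with
  | zero => exact hq
  | succ k ih =>
    refine ⟨hq, ?_⟩
    -- Differentiating `q g = 1` gives `q' = -q² g'`, whose right side is controlled to order `k` by
    -- induction. The sign is written as a constant function so that the product rule for bounded
    -- families applies.
    have h : ∀ i, (q i).deriv = ((-1 : ℂ) • (1 : SmoothCircle)) * (q i * q i * (g i).deriv) :=
      fun i => by
        have h1 : (q i).deriv * g i + q i * (g i).deriv = 0 := by
          rw [← SmoothCircle.deriv_mul, hgq]
          exact SmoothCircle.deriv_eq fun t => hasDerivAt_const t (1 : ℂ)
        rw [neg_smul, one_smul]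
        linear_combination (-(q i).deriv) * hgq i + q i * h1
    simp only [h]
    exact (boundedToOrder_smul (by simp) 1 k).mul ((ih.mul ih).mul (hg (k + 1)).2)

/-- Non-stationary phase: if `E i' = (2πi N i / q i) E i`, then integration by parts makes
`∫ (u i) (E i)` decay like any power of `N i`. -/
theorem exists_norm_integral_mul_le {E q u : ι → SmoothCircle} {N : ι → ℝ} (hN : ∀ i, 0 < N i)
    (hE1 : ∀ i x, ‖(E i).1 x‖ ≤ 1)
    (hE : ∀ i, (2 * Real.pi * Complex.I * N i : ℂ) • E i = q i * (E i).deriv)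
    (hq : ∀ k, BoundedToOrder k q) {k : ℕ} (hu : BoundedToOrder k u) :
    ∃ C : ℝ, ∀ i, ‖∫ x, (u i).1 x * (E i).1 x ∂haarAddCircle‖ ≤ C / N i ^ k := by
  induction k generalizing u with
  | zero =>
    obtain ⟨C, hC⟩ := hu
    refine ⟨C, fun i => ?_⟩
    have := norm_integral_le_of_norm_le_const (μ := (haarAddCircle : Measure UnitAddCircle))
      (f := fun x => (u i).1 x * (E i).1 x) (C := C * 1) (Filter.Eventually.of_forall fun x => by
        rw [norm_mul]
        exact mul_le_mul (hC i x) (hE1 i x) (norm_nonneg _) ((norm_nonneg _).trans (hC i x)))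
    simpa using this
  | succ k ih =>
    -- One integration by parts replaces `u` by `-(u q)'`: it costs one derivative and gains a
    -- factor `1/(2πN)`.
    obtain ⟨C, hC⟩ := ih (hu.mul (hq (k + 1))).2
    refine ⟨C, fun i => ?_⟩
    have h1 : (2 * Real.pi * Complex.I * N i : ℂ) * ∫ x, (u i).1 x * (E i).1 x ∂haarAddCircle =
        -∫ x, (u i * q i).deriv.1 x * (E i).1 x ∂haarAddCircle := by
      rw [← SmoothCircle.integral_mul_deriv, ← integral_const_mul]
      refine integral_congr_ae (Filter.Eventually.of_forall fun x => ?_)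
      have := congrArg (fun f : SmoothCircle => f.1 x) (hE i)
      simp only [SmoothCircle.smul_apply, SmoothCircle.mul_apply] at this ⊢
      linear_combination (u i).1 x * this
    have h2 : ‖(2 * Real.pi * Complex.I * N i : ℂ)‖ = 2 * Real.pi * N i := by
      simp [abs_of_pos Real.pi_pos, abs_of_pos (hN i)]
    have h3 := congrArg norm h1
    rw [norm_mul, h2, norm_neg] at h3
    have h4 := hC i
    rw [← h3, le_div_iff₀ (pow_pos (hN i) k)] at h4
    rw [le_div_iff₀ (pow_pos (hN i) _), pow_succ]
    refine le_trans ?_ h4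
    have h5 : 0 ≤ ‖∫ x, (u i).1 x * (E i).1 x ∂haarAddCircle‖ * (N i ^ k * N i) :=
      mul_nonneg (norm_nonneg _) (mul_nonneg (pow_nonneg (hN i).le k) (hN i).le)
    -- The gain `1/(2π)` is discarded, since `2π ≥ 1`.
    nlinarith [Real.pi_gt_three]

end UniformlyBoundedFamilies

/-! ### Decay of matrix coefficients between frequencies of different signs. -/

section OscillatoryMatrix

/-- Pairs of frequencies of different signs. -/
abbrev OppositeFrequencies : Type := {p : ℤ × ℤ // SignType.sign p.1 ≠ SignType.sign p.2}

/-- The total frequency `|m| + |n|`. -/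
noncomputable def totalFrequency (p : OppositeFrequencies) : ℝ := |(p.1.1 : ℝ)| + |(p.1.2 : ℝ)|

theorem one_le_totalFrequency (p : OppositeFrequencies) : 1 ≤ totalFrequency p := by
  have h : p.1.1 ≠ 0 ∨ p.1.2 ≠ 0 := by
    by_contra! h
    exact p.2 (by rw [h.1, h.2])
  have h1 : 1 ≤ |p.1.1| + |p.1.2| := by
    rcases h with h | h
    · have := Int.one_le_abs h
      have := abs_nonneg p.1.2
      omega
    · have := Int.one_le_abs h
      have := abs_nonneg p.1.1
      omega
  rw [totalFrequency]
  exact_mod_cast h1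

/-- When the signs differ and `j > 0`, the numbers `n j` and `-m` never have strictly opposite
signs, so no cancellation occurs. This is where preservation of orientation enters the estimate. -/
theorem abs_mul_sub_of_sign_ne {m n : ℤ} (h : SignType.sign m ≠ SignType.sign n) {j : ℝ}
    (hj : 0 < j) : |n * j - m| = |(n : ℝ)| * j + |(m : ℝ)| := by
  rcases lt_trichotomy n 0 with hn | rfl | hn
  · have hm : 0 ≤ m := by
      by_contra! hm
      exact h (by rw [sign_neg hm, sign_neg hn])
    have hn' : (n : ℝ) < 0 := by exact_mod_cast hn
    have hm' : (0 : ℝ) ≤ m := by exact_mod_cast hm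
    rw [abs_of_neg hn', abs_of_nonneg hm', abs_of_nonpos (by nlinarith)]
    ring
  · simp
  · have hm : m ≤ 0 := by
      by_contra! hm
      exact h (by rw [sign_pos hm, sign_pos hn])
    have hn' : (0 : ℝ) < n := by exact_mod_cast hn
    have hm' : (m : ℝ) ≤ 0 := by exact_mod_cast hm
    rw [abs_of_pos hn', abs_of_nonpos hm', abs_of_nonneg (by nlinarith)]
    ring

theorem exists_le_jac (φ : DiffCircle) : ∃ c > 0, c ≤ 1 ∧ ∀ x, c ≤ jac φ x := by
  obtain ⟨x₀, -, hx₀⟩ := isCompact_univ.exists_isMinOn (Set.univ_nonempty (α := UnitAddCircle))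
    (continuous_jac φ).continuousOn
  exact ⟨min (jac φ x₀) 1, lt_min (jac_pos φ x₀) one_pos, min_le_right _ _, fun x =>
    (min_le_left _ _).trans (hx₀ (Set.mem_univ x))⟩

theorem mul_totalFrequency_le (φ : DiffCircle) {c : ℝ} (hc1 : c ≤ 1) (hc : ∀ x, c ≤ jac φ x)
    (p : OppositeFrequencies) (x : UnitAddCircle) :
    c * totalFrequency p ≤ |p.1.2 * jac φ x - p.1.1| := by
  rw [abs_mul_sub_of_sign_ne p.2 (jac_pos φ x), totalFrequency]
  nlinarith [abs_nonneg (p.1.1 : ℝ), abs_nonneg (p.1.2 : ℝ), hc x]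

theorem mul_jac_sub_ne_zero (φ : DiffCircle) (p : OppositeFrequencies) (x : UnitAddCircle) :
    (p.1.2 : ℝ) * jac φ x - p.1.1 ≠ 0 := by
  obtain ⟨c, hc0, hc1, hc⟩ := exists_le_jac φ
  exact abs_pos.1 ((mul_pos hc0 (one_pos.trans_le (one_le_totalFrequency p))).trans_le
    (mul_totalFrequency_le φ hc1 hc p x))

/-- The normalized inverse derivative of the phase `n φ(x) - m x`. -/
noncomputable def inversePhase (φ : DiffCircle) (p : OppositeFrequencies) : SmoothCircle :=
  SmoothCircle.mk
    (fun x => ((totalFrequency p * (p.1.2 * jac φ x - p.1.1)⁻¹ : ℝ) : ℂ))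
    (Complex.ofRealCLM.contDiff.comp (contDiff_const.mul
      (((contDiff_const.mul (contDiff_jac φ)).sub contDiff_const).inv
        fun t => mul_jac_sub_ne_zero φ p t)))

theorem inversePhase_apply (φ : DiffCircle) (p : OppositeFrequencies) (x : UnitAddCircle) :
    (inversePhase φ p).1 x = ((totalFrequency p * (p.1.2 * jac φ x - p.1.1)⁻¹ : ℝ) : ℂ) := rfl

/-- The inverse of this function is `(nφ' - m)/N` with `N = |m| + |n|`, a combination of the fixed
functions `φ'` and `1` with coefficients of modulus at most `1`. It is bounded to every order
uniformly in `(m, n)`, and its modulus is at least `c > 0`, so `BoundedToOrder.inv` applies. -/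
theorem boundedToOrder_inversePhase (φ : DiffCircle) (k : ℕ) :
    BoundedToOrder k (inversePhase φ) := by
  have hN : ∀ p, 0 < totalFrequency p := fun p => one_pos.trans_le (one_le_totalFrequency p)
  have h1 : ∀ p : OppositeFrequencies, ‖((p.1.2 / totalFrequency p : ℝ) : ℂ)‖ ≤ 1 := fun p => by
    rw [Complex.norm_real, norm_div, Real.norm_of_nonneg (hN p).le, div_le_one (hN p)]
    exact le_add_of_nonneg_left (abs_nonneg _)
  have h2 : ∀ p : OppositeFrequencies, ‖((-p.1.1 / totalFrequency p : ℝ) : ℂ)‖ ≤ 1 := fun p => by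
    rw [Complex.norm_real, norm_div, norm_neg, Real.norm_of_nonneg (hN p).le, div_le_one (hN p)]
    exact le_add_of_nonneg_right (abs_nonneg _)
  refine BoundedToOrder.inv (g := fun p => ((p.1.2 / totalFrequency p : ℝ) : ℂ) • jacFun φ +
    ((-p.1.1 / totalFrequency p : ℝ) : ℂ) • 1)
    (fun k => (boundedToOrder_smul h1 _ k).add (boundedToOrder_smul h2 _ k)) ?_ (fun p => ?_) k
  · obtain ⟨c, hc0, hc1, hc⟩ := exists_le_jac φ
    refine ⟨c⁻¹, fun p x => ?_⟩
    have h3 := mul_totalFrequency_le φ hc1 hc p x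
    have h4 := abs_pos.2 (mul_jac_sub_ne_zero φ p x)
    rw [inversePhase_apply, Complex.norm_real, norm_mul, norm_inv, Real.norm_of_nonneg (hN p).le,
      Real.norm_eq_abs, ← div_eq_mul_inv, div_le_iff₀ h4, inv_mul_eq_div, le_div_iff₀ hc0, mul_comm]
    exact h3
  · refine SmoothCircle.ext fun x => ?_
    have h3 := mul_jac_sub_ne_zero φ p x
    have h4 := (hN p).ne'
    change ((totalFrequency p * (p.1.2 * jac φ x - p.1.1)⁻¹ : ℝ) : ℂ) *
      (((p.1.2 / totalFrequency p : ℝ) : ℂ) * (jac φ x : ℂ) +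
        ((-p.1.1 / totalFrequency p : ℝ) : ℂ) * 1) = 1
    norm_cast
    field_simp
    push_cast
    ring

/-- The oscillating function `e^{2πi(n φ(x) - m x)}`. -/
noncomputable def oscillation (φ : DiffCircle) (p : ℤ × ℤ) : SmoothCircle :=
  φ⁻¹ • fourierSmooth p.2 * fourierSmooth (-p.1)

theorem oscillation_apply (φ : DiffCircle) (p : ℤ × ℤ) (x : UnitAddCircle) :
    (oscillation φ p).1 x = fourier p.2 (φ.1 x) * fourier (-p.1) x := rfl

theorem deriv_oscillation (φ : DiffCircle) (p : ℤ × ℤ) (x : UnitAddCircle) :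
    (oscillation φ p).deriv.1 x =
      2 * Real.pi * Complex.I * (p.2 * jac φ x - p.1) * (oscillation φ p).1 x := by
  rw [oscillation, SmoothCircle.deriv_mul, deriv_diff_smul, deriv_fourierSmooth, deriv_fourierSmooth,
    inv_inv]
  simp only [SmoothCircle.add_apply, SmoothCircle.mul_apply, SmoothCircle.smul_apply, jacFun_apply,
    smul_smoothCircle_apply]
  push_cast
  ring

/-- The matrix coefficients of weighted composition operators between frequencies of different signs
decay fast. -/
theorem exists_norm_repr_weighted_le (φ : DiffCircle) (w : SmoothCircle) :
    ∃ C : ℝ, 0 ≤ C ∧ ∀ m n : ℤ, SignType.sign m ≠ SignType.sign n →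
      ‖fourierBasis.repr (weighted w.1 φ (fourierBasis n)) m‖ ≤
        C / (|(m : ℝ)| + |(n : ℝ)|) ^ 3 := by
  -- Order `3` is what the Hilbert-Schmidt estimate uses: one power absorbs the eigenvalue `2πn`,
  -- one gives summability of squares over `n`, and one over `m`.
  have hw : BoundedToOrder 3 fun _ : OppositeFrequencies => w := by
    simpa using boundedToOrder_smul (c := fun _ : OppositeFrequencies => 1) (by simp) w 3
  obtain ⟨C, hC⟩ := exists_norm_integral_mul_le (E := fun p : OppositeFrequencies => oscillation φ p.1)
    (q := inversePhase φ) (N := totalFrequency)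
    (fun p => one_pos.trans_le (one_le_totalFrequency p)) (fun p x => by
      rw [oscillation_apply, norm_mul, fourier_apply, fourier_apply, Circle.norm_coe,
        Circle.norm_coe, one_mul]) (fun p => SmoothCircle.ext fun x => by
      have h := mul_jac_sub_ne_zero φ p x
      have h' : (p.1.2 * jac φ x - p.1.1 : ℂ) ≠ 0 := by exact_mod_cast h
      rw [SmoothCircle.smul_apply, SmoothCircle.mul_apply, deriv_oscillation, inversePhase_apply]
      push_cast
      field_simp)
    (boundedToOrder_inversePhase φ) hw
  refine ⟨max C 0, le_max_right _ _, fun m n h => ?_⟩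
  have h1 := hC ⟨(m, n), h⟩
  have h2 : fourierBasis.repr (weighted w.1 φ (fourierBasis n)) m =
      ∫ x, w.1 x * (oscillation φ (m, n)).1 x ∂haarAddCircle := by
    rw [fourierBasis_repr_eq_integral]
    refine integral_congr_ae ?_
    have h3 : (fourierBasis n : L2Circle) =ᵐ[haarAddCircle] fourier n := by
      rw [coe_fourierBasis]
      exact coeFn_fourierLp 2 n
    filter_upwards [weighted_ae w.1 φ (fourierBasis n),
      (quasiMeasurePreserving_diff φ).ae h3] with x h4 h5
    rw [h4, h5, oscillation_apply, mul_assoc]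
    rfl
  rw [h2]
  refine h1.trans ?_
  rw [totalFrequency]
  gcongr
  exact le_max_left _ _

end OscillatoryMatrix

/-! ### The sign of `D`, and the twisted commutators with `|D|`. -/

section AbsoluteValue

theorem norm_sign_diracEigenvalue_le (n : ℤ) :
    ‖((SignType.sign (diracEigenvalue n) : ℝ) : ℂ)‖ ≤ 1 := by
  rcases SignType.trichotomy (SignType.sign (diracEigenvalue n)) with h | h | h <;> simp [h]

/-- The sign of the Dirac operator. -/
noncomputable def diracSign : L2Circle →L[ℂ] L2Circle :=
  diagCLM fourierBasis zero_le_one norm_sign_diracEigenvalue_le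

theorem repr_diracSign (ξ : L2Circle) (n : ℤ) : fourierBasis.repr (diracSign ξ) n =
    (SignType.sign (diracEigenvalue n) : ℝ) * fourierBasis.repr ξ n := repr_diagCLM _ _ _ _ _

theorem diracSign_fourierBasis (n : ℤ) : diracSign (fourierBasis n) =
    ((SignType.sign (diracEigenvalue n) : ℝ) : ℂ) • (fourierBasis n : L2Circle) := by
  refine ext_repr fourierBasis fun m => ?_
  rw [repr_diracSign, map_smul, lp.coeFn_smul, Pi.smul_apply, smul_eq_mul, fourierBasis.repr_self,
    lp.single_apply]
  by_cases h : m = n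
  · subst h; rfl
  · simp [h]

theorem sign_diracEigenvalue (n : ℤ) :
    SignType.sign (diracEigenvalue n) = SignType.sign n := by
  rw [diracEigenvalue, sign_mul, sign_pos Real.two_pi_pos, one_mul]
  rcases lt_trichotomy n 0 with h | rfl | h
  · rw [sign_neg h, sign_neg (by exact_mod_cast h)]
  · simp
  · rw [sign_pos h, sign_pos (by exact_mod_cast h)]

/-- A reference vector: comparing coefficients with it turns entrywise bounds by `1/(1 + |m|)` into
norm bounds for the columns of the commutator. -/
theorem exists_repr_eq_inv_one_add_abs :
    ∃ α : L2Circle, ∀ m : ℤ, fourierBasis.repr α m = ((1 + |(m : ℝ)|)⁻¹ : ℝ) := by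
  have h : Memℓp (fun m : ℤ => (((1 + |(m : ℝ)|)⁻¹ : ℝ) : ℂ)) 2 := by
    refine (memℓp_gen_iff (by simp)).2 ?_
    refine Summable.of_nonneg_of_le (fun m => by positivity) (fun m => ?_)
      ((hasSum_ite_eq (0 : ℤ) (1 : ℝ)).summable.add
        (Real.summable_one_div_int_pow.2 one_lt_two))
    rw [Complex.norm_real, Real.norm_of_nonneg (by positivity), ENNReal.toReal_ofNat, Real.rpow_two]
    split_ifs with hm
    · simp [hm]
    · have h1 : 0 < |(m : ℝ)| := abs_pos.2 (by exact_mod_cast hm)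
      rw [zero_add, one_div, inv_pow, ← sq_abs (m : ℝ)]
      gcongr
      linarith
  exact ⟨fourierBasis.repr.symm ⟨_, h⟩, fun m => by rw [LinearIsometryEquiv.apply_symm_apply]⟩

theorem summable_diracSign_commutator (φ : DiffCircle) (w : SmoothCircle) :
    Summable fun n : ℤ => (|diracEigenvalue n| * ‖(diracSign * weighted w.1 φ -
      weighted w.1 φ * diracSign) (fourierBasis n)‖) ^ 2 := by
  obtain ⟨C, hC0, hC⟩ := exists_norm_repr_weighted_le φ w
  obtain ⟨α, hα⟩ := exists_repr_eq_inv_one_add_abs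
  refine Summable.of_nonneg_of_le (fun n => sq_nonneg _) (fun n => ?_)
    ((Real.summable_one_div_int_pow.2 one_lt_two).mul_left ((2 * Real.pi * (2 * C * ‖α‖)) ^ 2))
  by_cases hn : n = 0
  · simp [hn, diracEigenvalue]
  have hn1 : 1 ≤ |(n : ℝ)| := by exact_mod_cast Int.one_le_abs hn
  have hn0 : 0 < |(n : ℝ)| := one_pos.trans_le hn1
  have hK : ‖(diracSign * weighted w.1 φ - weighted w.1 φ * diracSign) (fourierBasis n)‖ ≤
      2 * C / |(n : ℝ)| ^ 2 * ‖α‖ := by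
    refine norm_le_mul_norm_of_repr fourierBasis (by positivity) fun m => ?_
    rw [sub_apply, mul_apply_eq_comp, mul_apply_eq_comp, diracSign_fourierBasis, map_sub, map_smul,
      map_smul, lp.coeFn_sub, lp.coeFn_smul, Pi.sub_apply, Pi.smul_apply, repr_diracSign,
      smul_eq_mul, ← sub_mul, norm_mul, hα, Complex.norm_real, Real.norm_of_nonneg (by positivity)]
    -- The `(m, n)` entry of the commutator is `sign m - sign n` times that of the operator, hence
    -- zero for equal signs and at most twice as large in modulus otherwise.
    by_cases hs : SignType.sign m = SignType.sign n
    · rw [sign_diracEigenvalue, sign_diracEigenvalue, hs, sub_self, norm_zero, zero_mul]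
      positivity
    · have h1 : ‖((SignType.sign (diracEigenvalue m) : ℝ) : ℂ) -
          ((SignType.sign (diracEigenvalue n) : ℝ) : ℂ)‖ ≤ 2 := by
        have := norm_sub_le_of_le (norm_sign_diracEigenvalue_le m) (norm_sign_diracEigenvalue_le n)
        linarith
      -- The three powers are split as two for `n` and one for `m`, using `|n| ≥ 1`.
      have h2 : |(n : ℝ)| ^ 2 * (1 + |(m : ℝ)|) ≤ (|(m : ℝ)| + |(n : ℝ)|) ^ 3 := by
        have hm := abs_nonneg (m : ℝ)
        rw [pow_succ _ 2]
        exact mul_le_mul (pow_le_pow_left₀ hn0.le (by linarith) 2) (by linarith) (by positivity)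
          (by positivity)
      calc _ ≤ 2 * (C / (|(m : ℝ)| + |(n : ℝ)|) ^ 3) :=
            mul_le_mul h1 (hC m n hs) (norm_nonneg _) zero_le_two
        _ ≤ 2 * (C / (|(n : ℝ)| ^ 2 * (1 + |(m : ℝ)|))) := by gcongr
        _ = _ := by field_simp
  have h3 : |diracEigenvalue n| * ‖(diracSign * weighted w.1 φ -
      weighted w.1 φ * diracSign) (fourierBasis n)‖ ≤ 2 * Real.pi * (2 * C * ‖α‖) / |(n : ℝ)| := by
    rw [diracEigenvalue, abs_mul, abs_of_pos Real.two_pi_pos]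
    refine (mul_le_mul_of_nonneg_left hK (by positivity)).trans (le_of_eq ?_)
    field_simp
  refine (pow_le_pow_left₀ (by positivity) h3 2).trans (le_of_eq ?_)
  rw [div_pow, sq_abs, mul_one_div]

theorem hasBoundedTwistedCommutator_abs_weighted (φ : DiffCircle) (w : SmoothCircle) :
    HasBoundedTwistedCommutator (diagOp fourierBasis fun n => |diracEigenvalue n|)
      (weighted w.1 φ) (weighted (jacFun φ * w).1 φ) := by
  have h := hasBoundedTwistedCommutator_weighted φ w
  rw [dirac_eq_diagOp] at h
  -- Only the commutator of the sign with `T` enters, so the decay estimate is applied to the weight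
  -- `φ' w`.
  exact h.abs_diagOp fourierBasis repr_diracSign (summable_diracSign_commutator φ (jacFun φ * w))

theorem exists_isModulus_dirac (Γ : Subgroup DiffCircle) :
    ∃ T : L2Circle →ₗ.[ℂ] L2Circle, IsModulus dirac T ∧
      ∀ a : CrossedProduct Γ, HasBoundedTwistedCommutator T (rep Γ a) (rep Γ (sigma Γ a)) :=
  ⟨diagOp fourierBasis fun n => |diracEigenvalue n|,
    dirac_eq_diagOp ▸ isModulus_diagOp fourierBasis diracEigenvalue,
    hasBoundedTwistedCommutator_rep hasBoundedTwistedCommutator_abs_weighted⟩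

theorem isSigmaSpectralTriple_dirac (Γ : Subgroup DiffCircle) :
    IsSigmaSpectralTriple (sigma Γ) (rep Γ) dirac where
  isSelfAdjoint := dirac_eq_diagOp ▸ isSelfAdjoint_diagOp _ _
  compactResolvent := dirac_eq_diagOp ▸
    hasCompactResolvent_diagOp fourierBasis finite_abs_diracEigenvalue_lt
  bounded := hasBoundedTwistedCommutator_rep hasBoundedTwistedCommutator_weighted
  unitarity := sigma_star

end AbsoluteValue

end TransverseTriple

theorem mainTheorem8 (Γ : Subgroup DiffCircle) :
    (∀ a : CrossedProduct Γ,
      HasBoundedTwistedCommutator dirac (rep Γ a) (rep Γ (sigma Γ a))) ∧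
    (∃ absDirac : L2Circle →ₗ.[ℂ] L2Circle, IsModulus dirac absDirac ∧
      ∀ a : CrossedProduct Γ,
        HasBoundedTwistedCommutator absDirac (rep Γ a) (rep Γ (sigma Γ a))) ∧
    IsLipschitzRegularTriple (sigma Γ) (rep Γ) dirac ∧
    IsFinitelySummable 1 dirac :=
  ⟨(isSigmaSpectralTriple_dirac Γ).bounded, exists_isModulus_dirac Γ,
    ⟨isSigmaSpectralTriple_dirac Γ, exists_isModulus_dirac Γ⟩, isFinitelySummable_dirac⟩
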